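/- **Conventions.** Let $n\ge r\ge 1$. Equip $\mathbb R^{r\times n}$ with the Frobenius norm, and let $\operatorname{SO}(r)$ act on it by left multiplication. The orbit space $\mathbb R^{r\times n}/\operatorname{SO}(r)$ carries the metric $d([X],[Y])=\inf\{\|P-Q\|_F : P\in[X],\,Q\in[Y]\}$. For a map $f\colon M\to N$ of metric spaces let $\alpha,\beta\in[0,\infty]$ be the largest and the smallest constants, respectively, with $\alpha\, d(x,x')\le d(f(x),f(x'))\le\beta\, d(x,x')$ for all $x,x'\in M$. The distortion of $f$ is $\kappa(f)=\beta/\alpha$, with $\kappa(f)=\infty$ if $\alpha=0$ or $\beta=\infty$. The Euclidean distortion $c_2(M)$ is the infimum of $\kappa(f)$ over all maps $f$ from $M$ to a real Hilbert space. For $X\in\mathbb R^{r\times n}$ let $\phi(X)=\sqrt{X^TX}\in\mathbb R^{n\times n}$ be the positive semidefinite square root, let $\sigma_1(X)\ge\dots\ge\sigma_r(X)$ be the $r$ largest singular values, $\Sigma_X=\operatorname{diag}(\sigma_1(X),\dots,\sigma_r(X))$, and $\sigma_{\min}(X)=\sigma_r(X)$. For $V\in\mathbb R^{r\times n}$ let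 $\operatorname{Pl\ddot u}(V)\in\mathbb R^{\binom nr}$ be the vector of determinants of all $r\times r$ submatrices of $V$. A thin singular value decomposition of $X$ is a factorization $X=U_X\Sigma_XV_X$ with $U_X\in\operatorname{SO}(r)$, $V_X\in\mathbb R^{r\times n}$ and $V_XV_X^T=\operatorname{Id}_r$. **Theorem.** Let $n\ge r\ge1$. Every $X\in\mathbb R^{r\times n}$ has a thin singular value decomposition, and $$F([X])=\bigl(\phi(X),\ \sqrt2\cdot\sigma_{\min}(X)\cdot\operatorname{Pl\ddot u}(V_X)\bigr),$$ where $X=U_X\Sigma_XV_X$ is any thin singular value decomposition, gives a well-defined map $$F\colon\mathbb R^{r\times n}/\operatorname{SO}(r)\to\mathbb R^{n\times n}\times\mathbb R^{\binom nr}$$ (independent of the representative $X$ and of the decomposition). Here the target is a Hilbert space with the Frobenius norm on the first factor, the Euclidean norm on the second, and the $\ell^2$ norm on the product. This map has distortion $\kappa(F)\le2\sqrt2$. Moreover, for all $n\ge r\ge2$, $$\sqrt2\ \le\ c_2\bigl(\mathbb R^{r\times n}/\operatorname{SO}(r)\bigr)\ \le\ 2\sqrt2 .$$ -/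

import Mathlib

open scoped ENNReal MatrixOrder

universe u v w

/-! ### Distortion -/

section Distortion

/-- The optimal lower Lipschitz bound of `f`: the largest `α ∈ [0,∞]` such that
`α · d(x,x') ≤ d(f x, f x')` for all `x, x'`. -/
noncomputable def lowerLipschitzBound {X : Type u} {Y : Type w} [MetricSpace X] [MetricSpace Y]
    (f : X → Y) : ℝ≥0∞ :=
  sSup {α : ℝ≥0∞ | ∀ x x' : X, α * edist x x' ≤ edist (f x) (f x')}

/-- The optimal upper Lipschitz bound of `f`: the smallest `β ∈ [0,∞]` such that
`d(f x, f x') ≤ β · d(x,x')` for all `x, x'`. -/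
noncomputable def upperLipschitzBound {X : Type u} {Y : Type w} [MetricSpace X] [MetricSpace Y]
    (f : X → Y) : ℝ≥0∞ :=
  sInf {β : ℝ≥0∞ | ∀ x x' : X, edist (f x) (f x') ≤ β * edist x x'}

open Classical in
/-- The distortion `κ(f) = β / α`, with `κ(f) = ∞` if `α = 0` or `β = ∞`. -/
noncomputable def distortion {X : Type u} {Y : Type w} [MetricSpace X] [MetricSpace Y]
    (f : X → Y) : ℝ≥0∞ :=
  if lowerLipschitzBound f = 0 ∨ upperLipschitzBound f = ∞ then ∞
  else upperLipschitzBound f / lowerLipschitzBound f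

/-- The Euclidean distortion `c₂(X)`: the infimum of the distortions of maps from `X` to real
Hilbert spaces (living in an arbitrary universe `v`). -/
noncomputable def euclideanDistortion (X : Type u) [MetricSpace X] : ℝ≥0∞ :=
  sInf {c : ℝ≥0∞ | ∃ (H : Type v) (_ : NormedAddCommGroup H) (_ : InnerProductSpace ℝ H)
    (_ : CompleteSpace H) (f : X → H), distortion f = c}

end Distortion

/-! ### Orbit spaces -/

section OrbitSpace

/-- The orbit space `X / G`. -/
def OrbitSpace (G : Type u) (X : Type w) [Group G] [MulAction G X] : Type w :=
  MulAction.orbitRel.Quotient G X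

namespace OrbitSpace

variable {G : Type u} {X : Type w} [Group G] [MulAction G X]

variable (G) in
/-- The orbit `[x]` as a point of `X / G`. -/
def mk (x : X) : OrbitSpace G X := (Quotient.mk'' x : MulAction.orbitRel.Quotient G X)

/-- The orbit represented by a point of `X / G`, as a subset of `X`. -/
def orbit (a : OrbitSpace G X) : Set X := MulAction.orbitRel.Quotient.orbit a

/-- `d([x],[y])` is the infimum of `d(p,q)` over `p ∈ [x]` and `q ∈ [y]`. -/
noncomputable instance [PseudoMetricSpace X] : Dist (OrbitSpace G X) where
  dist a b := sInf ((fun p : X × X => dist p.1 p.2) '' (a.orbit ×ˢ b.orbit))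

theorem orbit_mk (x : X) : (mk G x).orbit = MulAction.orbit G x := rfl

theorem mk_surjective : Function.Surjective (mk G : X → OrbitSpace G X) :=
  Quotient.mk''_surjective

theorem mk_eq_mk {x y : X} : mk G x = mk G y ↔ x ∈ MulAction.orbit G y :=
  Quotient.eq''.trans MulAction.orbitRel_apply

theorem dist_mk_mk [PseudoMetricSpace X] [IsIsometricSMul G X] (x y : X) :
    dist (mk G x) (mk G y) = Metric.infDist x (MulAction.orbit G y) := by
  have hne : (MulAction.orbit G y).Nonempty := MulAction.nonempty_orbit y
  apply le_antisymm
  · rw [Metric.le_infDist hne]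
    intro q hq
    refine csInf_le ⟨0, ?_⟩ ⟨(x, q), ⟨MulAction.mem_orbit_self x, hq⟩, rfl⟩
    rintro _ ⟨p, -, rfl⟩
    exact dist_nonneg
  · apply le_csInf
    · exact ⟨_, (x, y), ⟨MulAction.mem_orbit_self x, MulAction.mem_orbit_self y⟩, rfl⟩
    · rintro _ ⟨⟨_, _⟩, ⟨⟨g, rfl⟩, ⟨h, rfl⟩⟩, rfl⟩
      have := Metric.infDist_le_dist_of_mem (x := x)
        (MulAction.mem_orbit y (g⁻¹ * h) : (g⁻¹ * h) • y ∈ MulAction.orbit G y)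
      rw [← dist_smul g x, smul_smul, mul_inv_cancel_left] at this
      exact this

noncomputable instance [PseudoMetricSpace X] [IsIsometricSMul G X] :
    PseudoMetricSpace (OrbitSpace G X) where
  dist_self a := by
    obtain ⟨x, rfl⟩ := mk_surjective a
    rw [dist_mk_mk, Metric.infDist_zero_of_mem (MulAction.mem_orbit_self x)]
  dist_comm a b := by
    refine congrArg sInf (Set.ext fun t => ?_)
    constructor <;> rintro ⟨⟨p, q⟩, ⟨hp, hq⟩, rfl⟩ <;> exact ⟨(q, p), ⟨hq, hp⟩, dist_comm _ _⟩
  dist_triangle a b c := by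
    obtain ⟨x, rfl⟩ := mk_surjective a
    obtain ⟨y, rfl⟩ := mk_surjective b
    obtain ⟨z, rfl⟩ := mk_surjective c
    simp only [dist_mk_mk]
    refine le_of_forall_pos_le_add fun ε hε => ?_
    obtain ⟨_, ⟨g, rfl⟩, hg⟩ := (Metric.infDist_lt_iff (MulAction.nonempty_orbit (M := G) y)).1
      (lt_add_of_pos_right (Metric.infDist x (MulAction.orbit G y)) (half_pos hε))
    obtain ⟨_, ⟨h, rfl⟩, hh⟩ := (Metric.infDist_lt_iff (MulAction.nonempty_orbit (M := G) z)).1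
      (lt_add_of_pos_right (Metric.infDist y (MulAction.orbit G z)) (half_pos hε))
    have h1 := Metric.infDist_le_dist_of_mem (x := x)
      (MulAction.mem_orbit z (g * h) : (g * h) • z ∈ MulAction.orbit G z)
    have h2 := dist_triangle x (g • y) ((g * h) • z)
    rw [mul_smul, dist_smul, ← mul_smul] at h2
    simp only at hg hh
    linarith

/-- If the orbits are closed, then the orbit space is a metric space. -/
noncomputable abbrev metricSpaceOfIsClosed [PseudoMetricSpace X] [IsIsometricSMul G X]
    (hc : ∀ x : X, IsClosed (MulAction.orbit G x)) : MetricSpace (OrbitSpace G X) where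
  eq_of_dist_eq_zero {a b} hab := by
    obtain ⟨x, rfl⟩ := mk_surjective a
    obtain ⟨y, rfl⟩ := mk_surjective b
    rw [dist_mk_mk] at hab
    exact mk_eq_mk.2 (((hc y).mem_iff_infDist_zero (MulAction.nonempty_orbit y)).2 hab)

end OrbitSpace

end OrbitSpace

/-! ### The invariants -/

section Invariants

/-- `φ(X) = √(XᵀX)`, the positive semidefinite square root of the Gram matrix. -/
noncomputable def gramSqrt {r n : ℕ} (X : Matrix (Fin r) (Fin n) ℝ) : Matrix (Fin n) (Fin n) ℝ :=
  CFC.sqrt (X.transpose * X)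

/-- The `i`-th singular value of `X` (zero-indexed, in decreasing order). -/
noncomputable def singVal {r n : ℕ} (X : Matrix (Fin r) (Fin n) ℝ) (i : ℕ) : ℝ :=
  X.toEuclideanLin.singularValues i

/-- `σ_min(X)`, the smallest, i.e. `r`-th largest, singular value of an `r × n` matrix
(where `n ≥ r ≥ 1`). -/
noncomputable def sigmaMin {r n : ℕ} (X : Matrix (Fin r) (Fin n) ℝ) : ℝ :=
  singVal X (r - 1)

/-- `X = U Σ V` is a thin singular value decomposition with `U ∈ SO(r)` and `V Vᵀ = 1`, where
`Σ` is the diagonal matrix of the `r` largest singular values of `X`. -/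
structure IsThinSVD {r n : ℕ} (X : Matrix (Fin r) (Fin n) ℝ) (U : Matrix (Fin r) (Fin r) ℝ)
    (V : Matrix (Fin r) (Fin n) ℝ) : Prop where
  mem_so : U ∈ Matrix.specialOrthogonalGroup (Fin r) ℝ
  mul_transpose : V * V.transpose = 1
  eq_mul : X = U * Matrix.diagonal (fun i : Fin r => singVal X i) * V

noncomputable instance instFintypeMinorIndex (r n : ℕ) : Fintype (Fin r ↪o Fin n) :=
  Fintype.ofInjective (fun s : Fin r ↪o Fin n => (s : Fin r → Fin n)) DFunLike.coe_injective

/-- Plücker coordinates: the `n.choose r` determinants of the `r × r` submatrices of `X`, one for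
each increasing choice of `r` columns. -/
noncomputable def plucker {r n : ℕ} (X : Matrix (Fin r) (Fin n) ℝ) :
    EuclideanSpace ℝ (Fin r ↪o Fin n) :=
  WithLp.toLp 2 fun s => (X.submatrix id s).det

end Invariants

/-! ### `SO(r)` acting on `r × n` matrices with the Frobenius metric -/

open scoped Matrix.Norms.Frobenius

section Action

variable {r n : ℕ}

/-- `SO(r)` acts on `r × n` matrices by left multiplication. -/
instance instMulActionSO : MulAction (Matrix.specialOrthogonalGroup (Fin r) ℝ)
    (Matrix (Fin r) (Fin n) ℝ) where
  smul Q X := (Q : Matrix (Fin r) (Fin r) ℝ) * X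
  one_smul X := Matrix.one_mul X
  mul_smul Q R X := Matrix.mul_assoc (Q : Matrix (Fin r) (Fin r) ℝ) R X

theorem so_smul_def (Q : Matrix.specialOrthogonalGroup (Fin r) ℝ) (X : Matrix (Fin r) (Fin n) ℝ) :
    Q • X = (Q : Matrix (Fin r) (Fin r) ℝ) * X := rfl

theorem frobenius_norm_sq (X : Matrix (Fin r) (Fin n) ℝ) :
    ‖X‖ ^ 2 = (X.transpose * X).trace := by
  rw [Matrix.frobenius_norm_def, ← Real.sqrt_eq_rpow, Real.sq_sqrt (by positivity)]
  simp only [Matrix.trace, Matrix.diag_apply, Matrix.mul_apply, Matrix.transpose_apply]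
  rw [Finset.sum_comm]
  refine Finset.sum_congr rfl fun i _ => Finset.sum_congr rfl fun j _ => ?_
  norm_num [pow_two]

instance instIsIsometricSMulSO : IsIsometricSMul (Matrix.specialOrthogonalGroup (Fin r) ℝ)
    (Matrix (Fin r) (Fin n) ℝ) where
  isometry_smul Q := Isometry.of_dist_eq fun X Y => by
    rw [so_smul_def, so_smul_def, dist_eq_norm, dist_eq_norm, ← Matrix.mul_sub]
    rw [← sq_eq_sq₀ (norm_nonneg _) (norm_nonneg _), frobenius_norm_sq, frobenius_norm_sq,
      Matrix.transpose_mul, Matrix.mul_assoc, ← Matrix.mul_assoc (Matrix.transpose Q.1),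
      (Matrix.mem_orthogonalGroup_iff' (Fin r) ℝ).1
        (Matrix.mem_specialOrthogonalGroup_iff.1 Q.2).1, Matrix.one_mul]

instance instCompactSpaceSO : CompactSpace (Matrix.specialOrthogonalGroup (Fin r) ℝ) := by
  refine isCompact_iff_compactSpace.1 (Metric.isCompact_of_isClosed_isBounded ?_ ?_)
  · have : (Matrix.specialOrthogonalGroup (Fin r) ℝ : Set (Matrix (Fin r) (Fin r) ℝ)) =
        {A | A.transpose * A = 1} ∩ {A | A.det = 1} := by
      ext A
      exact Matrix.mem_specialOrthogonalGroup_iff.trans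
        (and_congr_left' (Matrix.mem_orthogonalGroup_iff' (Fin r) ℝ))
    rw [this]
    exact (isClosed_eq (by fun_prop) continuous_const).inter
      (isClosed_eq (by fun_prop) continuous_const)
  · refine (Metric.isBounded_closedBall (x := 0) (r := √r)).subset fun A hA => ?_
    rw [mem_closedBall_zero_iff]
    refine Real.le_sqrt_of_sq_le ?_
    rw [frobenius_norm_sq, (Matrix.mem_orthogonalGroup_iff' (Fin r) ℝ).1
        (Matrix.mem_specialOrthogonalGroup_iff.1 hA).1]
    simp

theorem isClosed_orbit_so (X : Matrix (Fin r) (Fin n) ℝ) :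
    IsClosed (MulAction.orbit (Matrix.specialOrthogonalGroup (Fin r) ℝ) X) := by
  have h : Continuous fun Q : Matrix.specialOrthogonalGroup (Fin r) ℝ =>
      (Q : Matrix (Fin r) (Fin r) ℝ) * X := continuous_subtype_val.matrix_mul continuous_const
  exact (isCompact_range h).isClosed

end Action

/-- The orbit space `ℝ^{r×n} / SO(r)`. -/
abbrev MatrixModSO (r n : ℕ) : Type :=
  OrbitSpace (Matrix.specialOrthogonalGroup (Fin r) ℝ) (Matrix (Fin r) (Fin n) ℝ)

noncomputable instance instMetricSpaceMatrixModSO (r n : ℕ) : MetricSpace (MatrixModSO r n) :=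
  OrbitSpace.metricSpaceOfIsClosed isClosed_orbit_so

/-- The Hilbert space `ℝ^{n×n} × ℝ^{n choose r}`, with the Frobenius norm on the first factor, the
Euclidean norm on the second, and the `ℓ²` norm on the product. -/
abbrev GramPluckerSpace (r n : ℕ) : Type :=
  WithLp 2 (Matrix (Fin n) (Fin n) ℝ × EuclideanSpace ℝ (Fin r ↪o Fin n))

/-! ### The Cauchy–Binet formula -/

section CauchyBinet

open Finset Matrix

variable {r n : ℕ}

/-! Write X = Ux S Vx, Y = Uy T Vy, N = Vx Vyᵀ, a = σ_min(X), b = σ_min(Y). By Cauchy–Binet, Plücker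
vectors of orthonormal frames are unit vectors with inner product det N, so no further minors occur.

Upper bound: φ is √2-Lipschitz (`norm_gramSqrt_sub_sq_le`) and σ_min · Plü is 1-Lipschitz
(`norm_smul_plucker_sub_le`), hence F is 2-Lipschitz, as 2 + 2 · 1 = 2². The second estimate rests
on tr K ≤ r - 1 + det K for contractions K. Taking X = Y in it also shows that F does not depend on
the decomposition.

Lower bound: Procrustes alignment gives an orthogonal Q with ‖X - QY‖ ≤ δ = ‖φ(X) - φ(Y)‖, whose
determinant may be taken to be the sign of det N. If det N ≥ 0, then Q is a rotation. Otherwise a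
reflection of the smallest singular direction of X or Y repairs Q, so that d ≤ δ + a + b on
averaging; now the Plücker vectors are at an obtuse angle, and the second component of F pays for a
+ b. This gives d² ≤ 2 d(F, F)², hence distortion 2√2.

For the lower bound on c₂, r ≥ 2 makes [X] = [-X] on rank one matrices, so the orbit space contains
a circle of unit vectors modulo sign. A Wirtinger inequality for closed polygons in a Hilbert space
(`sum_norm_antipodal_sq_le`), applied to ever finer polygons on it, forces distortion at least √2.
-/

theorem det_mul_transpose_eq_sum_fun (V W : Matrix (Fin r) (Fin n) ℝ) :
    (V * W.transpose).det =
      ∑ f : Fin r → Fin n, (∏ i, W i (f i)) * (V.submatrix id f).det := by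
  rw [← det_transpose]
  have h : (V * W.transpose).transpose = fun i => ∑ j, W i j • V.transpose j := by
    ext i k
    simp [mul_apply, Finset.sum_apply, mul_comm]
  change detRowAlternating (V * W.transpose).transpose = _
  rw [h]
  change (detRowAlternating (R := ℝ) (n := Fin r)).toMultilinearMap _ = _
  rw [MultilinearMap.map_sum]
  refine sum_congr rfl fun f _ => ?_
  rw [MultilinearMap.map_smul_univ, smul_eq_mul]
  congr 1
  rw [← det_transpose (V.submatrix id f)]
  rfl

/-- Sorting the values of an injective function makes it strictly increasing; undoing the sort is
the permutation. -/
theorem injective_fun_eq_orderEmb_comp_perm (f : Fin r → Fin n) (hf : Function.Injective f) :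
    ∃ (s : Fin r ↪o Fin n) (σ : Equiv.Perm (Fin r)), (fun i => s (σ i)) = f := by
  have hm : StrictMono (f ∘ Tuple.sort f) :=
    (Tuple.monotone_sort f).strictMono_of_injective (hf.comp (Tuple.sort f).injective)
  refine ⟨OrderEmbedding.ofStrictMono _ hm, (Tuple.sort f)⁻¹, ?_⟩
  ext i
  simp

/-- A permutation of the source does not change the range, and an increasing map is determined by
its range. -/
theorem orderEmb_comp_perm_injective {s s' : Fin r ↪o Fin n} {σ σ' : Equiv.Perm (Fin r)}
    (h : (fun i => s (σ i)) = fun i => s' (σ' i)) : s = s' ∧ σ = σ' := by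
  have hs : s = s' := by
    rw [← OrderEmbedding.range_inj]
    rw [← σ.surjective.range_comp s, ← σ'.surjective.range_comp s']
    exact congrArg Set.range h
  subst hs
  exact ⟨rfl, Equiv.ext fun i => s.injective (congrFun h i)⟩

/-- The Cauchy–Binet formula. -/
theorem det_mul_transpose_eq_sum_minors (V W : Matrix (Fin r) (Fin n) ℝ) :
    (V * W.transpose).det =
      ∑ s : Fin r ↪o Fin n, (V.submatrix id s).det * (W.submatrix id s).det := by
  classical
  have h1 : ∀ s : Fin r ↪o Fin n, (V.submatrix id s).det * (W.submatrix id s).det =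
      ∑ σ : Equiv.Perm (Fin r),
        (∏ i, W i (s (σ i))) * (V.submatrix id fun i => s (σ i)).det := by
    intro s
    rw [← det_transpose (W.submatrix id s), det_apply' (W.submatrix id s).transpose, mul_sum]
    refine sum_congr rfl fun σ _ => ?_
    have : (V.submatrix id fun i => s (σ i)) = (V.submatrix id s).submatrix id σ := rfl
    rw [this, det_permute']
    simp only [transpose_apply, submatrix_apply, id]
    ring
  rw [det_mul_transpose_eq_sum_fun, sum_congr rfl fun s _ => h1 s, ← sum_product',
    ← sum_subset (s₁ := univ.filter Function.Injective) (subset_univ _)]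
  · symm
    refine sum_bij (fun x _ i => x.1 (x.2 i)) ?_ ?_ ?_ ?_
    · intro x _
      exact mem_filter.2 ⟨mem_univ _, x.1.injective.comp x.2.injective⟩
    · rintro ⟨s, σ⟩ _ ⟨s', σ'⟩ _ h
      obtain ⟨rfl, rfl⟩ := orderEmb_comp_perm_injective h
      rfl
    · intro f hf
      obtain ⟨s, σ, h⟩ := injective_fun_eq_orderEmb_comp_perm f (by simpa using hf)
      exact ⟨(s, σ), by simp, h⟩
    · intro x _
      rfl
  · intro f _ hf
    obtain ⟨i, j, hij, hne⟩ : ∃ i j, f i = f j ∧ i ≠ j := by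
      simpa [Function.Injective] using hf
    rw [det_zero_of_column_eq hne (by intro k; simp [hij]), mul_zero]

theorem inner_plucker (V W : Matrix (Fin r) (Fin n) ℝ) :
    inner ℝ (plucker V) (plucker W) = (V * W.transpose).det := by
  rw [det_mul_transpose_eq_sum_minors, PiLp.inner_apply]
  exact sum_congr rfl fun s _ => mul_comm _ _

end CauchyBinet

/-! ### Contractions -/

section Contraction

open Finset Matrix

variable {r : ℕ}

/-- A real square matrix which does not increase the Euclidean norm. -/
def IsContraction (K : Matrix (Fin r) (Fin r) ℝ) : Prop :=
  ∀ x : Fin r → ℝ, (K *ᵥ x) ⬝ᵥ (K *ᵥ x) ≤ x ⬝ᵥ x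

theorem IsContraction.diag_le_one {K : Matrix (Fin r) (Fin r) ℝ} (hK : IsContraction K)
    (i : Fin r) : K i i ≤ 1 := by
  have h := hK (Pi.single i 1)
  rw [mulVec_single_one, single_dotProduct, Pi.single_eq_same, one_mul] at h
  have h2 : K i i * K i i ≤ K.col i ⬝ᵥ K.col i :=
    single_le_sum (f := fun j => K j i * K j i) (fun j _ => mul_self_nonneg _) (mem_univ i)
  nlinarith

/-- AᵀA is an orthogonal projection, and the residual y - AᵀAy has nonnegative squared length. -/
theorem dotProduct_mulVec_le_of_mul_transpose_eq_one {n : ℕ} {A : Matrix (Fin r) (Fin n) ℝ}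
    (hA : A * A.transpose = 1) (y : Fin n → ℝ) : (A *ᵥ y) ⬝ᵥ (A *ᵥ y) ≤ y ⬝ᵥ y := by
  have h : 0 ≤ (y - A.transpose *ᵥ (A *ᵥ y)) ⬝ᵥ (y - A.transpose *ᵥ (A *ᵥ y)) :=
    sum_nonneg fun i _ => mul_self_nonneg _
  have h1 : y ⬝ᵥ (A.transpose *ᵥ (A *ᵥ y)) = (A *ᵥ y) ⬝ᵥ (A *ᵥ y) := by
    rw [dotProduct_mulVec, vecMul_transpose]
  have h2 : (A.transpose *ᵥ (A *ᵥ y)) ⬝ᵥ (A.transpose *ᵥ (A *ᵥ y)) = (A *ᵥ y) ⬝ᵥ (A *ᵥ y) := by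
    rw [dotProduct_mulVec, vecMul_transpose, mulVec_mulVec, hA, one_mulVec]
  rw [sub_dotProduct, dotProduct_sub, dotProduct_sub, dotProduct_comm (_ *ᵥ _) y, h1, h2] at h
  linarith

theorem dotProduct_transpose_mulVec_of_mul_transpose_eq_one {n : ℕ} {A : Matrix (Fin r) (Fin n) ℝ}
    (hA : A * A.transpose = 1) (x : Fin r → ℝ) :
    (A.transpose *ᵥ x) ⬝ᵥ (A.transpose *ᵥ x) = x ⬝ᵥ x := by
  rw [dotProduct_mulVec, vecMul_transpose, mulVec_mulVec, hA, one_mulVec]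

theorem isContraction_mul_transpose {n : ℕ} {A B : Matrix (Fin r) (Fin n) ℝ}
    (hA : A * A.transpose = 1) (hB : B * B.transpose = 1) : IsContraction (A * B.transpose) := by
  intro x
  rw [← mulVec_mulVec]
  exact (dotProduct_mulVec_le_of_mul_transpose_eq_one hA _).trans
    (dotProduct_transpose_mulVec_of_mul_transpose_eq_one hB x).le

/-- Contractivity is only known on real vectors, so it is applied to the real and the imaginary part
of a complex eigenvector and the squared lengths are added. -/
theorem IsContraction.norm_root_charpoly_le_one {K : Matrix (Fin r) (Fin r) ℝ}
    (hK : IsContraction K) {z : ℂ} (hz : z ∈ (K.map Complex.ofRealHom).charpoly.roots) :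
    ‖z‖ ≤ 1 := by
  rw [Polynomial.mem_roots (charpoly_monic _).ne_zero] at hz
  have hdet : (scalar (Fin r) z - K.map Complex.ofRealHom).det = 0 := by
    rw [← eval_charpoly]; exact hz
  obtain ⟨w, hw0, hw⟩ := exists_mulVec_eq_zero_iff.2 hdet
  rw [sub_mulVec, sub_eq_zero] at hw
  set x : Fin r → ℝ := fun i => (w i).re
  set y : Fin r → ℝ := fun i => (w i).im
  have hw' : ∀ i, z * w i = (K *ᵥ x) i + (K *ᵥ y) i * Complex.I := by
    intro i
    have := congrFun hw i
    simp only [scalar_apply, mulVec_diagonal] at this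
    rw [this]
    simp only [mulVec, dotProduct, Complex.ofReal_sum, sum_mul, ← sum_add_distrib, map_apply]
    refine sum_congr rfl fun j _ => ?_
    simp only [Complex.ofRealHom_eq_coe, Complex.ofReal_mul, x, y]
    linear_combination (-(K i j : ℂ)) * Complex.re_add_im (w j)
  have hn : ∀ i, ‖z‖ ^ 2 * (x i * x i + y i * y i) =
      (K *ᵥ x) i * (K *ᵥ x) i + (K *ᵥ y) i * (K *ᵥ y) i := by
    intro i
    have := congrArg Complex.normSq (hw' i)
    rw [Complex.normSq_mul, Complex.normSq_add_mul_I, ← Complex.sq_norm,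
      Complex.normSq_apply] at this
    rw [this]; ring
  have hs : ‖z‖ ^ 2 * (x ⬝ᵥ x + y ⬝ᵥ y) ≤ x ⬝ᵥ x + y ⬝ᵥ y := by
    calc _ = (K *ᵥ x) ⬝ᵥ (K *ᵥ x) + (K *ᵥ y) ⬝ᵥ (K *ᵥ y) := by
          simp only [dotProduct, ← sum_add_distrib, mul_sum]
          exact sum_congr rfl fun i _ => hn i
      _ ≤ _ := add_le_add (hK x) (hK y)
  have hpos : 0 < x ⬝ᵥ x + y ⬝ᵥ y := by
    obtain ⟨i, hi⟩ := Function.ne_iff.1 hw0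
    simp only [dotProduct, ← sum_add_distrib]
    refine sum_pos' (fun j _ => add_nonneg (mul_self_nonneg _) (mul_self_nonneg _))
      ⟨i, mem_univ i, ?_⟩
    have := Complex.normSq_pos.2 hi
    rwa [Complex.normSq_apply] at this
  have : ‖z‖ ^ 2 ≤ 1 := by
    by_contra! h
    nlinarith
  nlinarith [norm_nonneg z]

/-- Along the segment from K to the identity the determinant changes sign; a zero at (1 - t)K + t ·
1 is the eigenvalue -t/(1 - t) of K. -/
theorem exists_nonpos_root_of_det_neg {K : Matrix (Fin r) (Fin r) ℝ} (hK : K.det < 0) :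
    ∃ t : ℝ, t ≤ 0 ∧ (t : ℂ) ∈ (K.map Complex.ofRealHom).charpoly.roots := by
  have hc : Continuous fun t : ℝ => ((1 - t) • K + t • (1 : Matrix (Fin r) (Fin r) ℝ)).det := by
    fun_prop
  obtain ⟨t, ht, h0⟩ := intermediate_value_Icc zero_le_one hc.continuousOn
    (show (0 : ℝ) ∈ Set.Icc _ _ by simp [hK.le])
  simp only at h0
  have ht1 : t ≠ 1 := by rintro rfl; simp at h0
  have ht2 : 0 < 1 - t := sub_pos.2 (lt_of_le_of_ne ht.2 ht1)
  refine ⟨-(t / (1 - t)), neg_nonpos.2 (div_nonneg ht.1 ht2.le), ?_⟩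
  rw [Polynomial.mem_roots (charpoly_monic _).ne_zero, charpoly_map]
  change Polynomial.IsRoot _ (Complex.ofRealHom _)
  apply Polynomial.IsRoot.map
  rw [Polynomial.IsRoot.def, eval_charpoly]
  have : scalar (Fin r) (-(t / (1 - t))) - K =
      (-(1 - t)⁻¹) • ((1 - t) • K + t • (1 : Matrix (Fin r) (Fin r) ℝ)) := by
    rw [smul_add, smul_smul, smul_smul, neg_mul, inv_mul_cancel₀ ht2.ne', neg_one_smul,
      scalar_apply, ← smul_one_eq_diagonal, sub_eq_neg_add]
    congr 2
    field_simp
  rw [this, det_smul, h0, mul_zero]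

/-- The inductive step for the sum is (1 - a)(1 - p) ≥ 0, with p the product of the remaining
elements. -/
theorem multiset_prod_le_one {s : Multiset ℝ} (h0 : ∀ x ∈ s, 0 ≤ x) (h1 : ∀ x ∈ s, x ≤ 1) :
    0 ≤ s.prod ∧ s.prod ≤ 1 ∧ s.sum ≤ s.card - 1 + s.prod := by
  induction s using Multiset.induction_on with
  | empty => simp
  | cons a s ih =>
    obtain ⟨i1, i2, i3⟩ := ih (fun x hx => h0 x (Multiset.mem_cons_of_mem hx))
      (fun x hx => h1 x (Multiset.mem_cons_of_mem hx))
    have a0 := h0 a (Multiset.mem_cons_self a s)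
    have a1 := h1 a (Multiset.mem_cons_self a s)
    simp only [Multiset.prod_cons, Multiset.sum_cons, Multiset.card_cons, Nat.cast_add,
      Nat.cast_one]
    refine ⟨by positivity, by nlinarith, by nlinarith⟩

/-- The trace of a contraction is controlled by its determinant. -/
theorem IsContraction.trace_le {K : Matrix (Fin r) (Fin r) ℝ} (hK : IsContraction K) :
    K.trace ≤ r - 1 + K.det := by
  set R := (K.map Complex.ofRealHom).charpoly.roots with hR
  have hcard : R.card = r := by
    have := (IsAlgClosed.splits (K.map Complex.ofRealHom).charpoly).natDegree_eq_card_roots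
    rw [charpoly_natDegree_eq_dim, Fintype.card_fin] at this
    exact this.symm
  have htr : K.trace = (R.map Complex.re).sum := by
    have h := trace_eq_sum_roots_charpoly (K.map Complex.ofRealHom)
    have h2 : (K.map Complex.ofRealHom).trace = (K.trace : ℂ) := by
      simp [trace]
    rw [h2] at h
    have := congrArg Complex.re h
    rw [Complex.ofReal_re] at this
    rw [this]
    exact map_multiset_sum Complex.reLm R
  have hdet : |K.det| = (R.map norm).prod := by
    have h := det_eq_prod_roots_charpoly (K.map Complex.ofRealHom)
    have h2 : (K.map Complex.ofRealHom).det = (K.det : ℂ) :=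
      (RingHom.map_det Complex.ofRealHom K).symm
    rw [h2] at h
    have := congrArg norm h
    rw [Complex.norm_real, Real.norm_eq_abs] at this
    rw [this]
    exact map_multiset_prod (normHom : ℂ →*₀ ℝ) R
  have key : ∀ S : Multiset ℂ, S ≤ R → (0 ≤ (S.map norm).prod ∧ (S.map norm).prod ≤ 1 ∧
      (S.map norm).sum ≤ S.card - 1 + (S.map norm).prod) ∧
      (S.map Complex.re).sum ≤ (S.map norm).sum := by
    intro S hS
    constructor
    · have := multiset_prod_le_one (s := S.map norm) (by simp) (by
        intro x hx
        obtain ⟨z, hz, rfl⟩ := Multiset.mem_map.1 hx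
        exact hK.norm_root_charpoly_le_one (Multiset.mem_of_le hS hz))
      simpa using this
    · exact Multiset.sum_map_le_sum_map _ _ fun z _ => Complex.re_le_norm z
  rcases le_or_gt 0 K.det with h | h
  · obtain ⟨⟨-, -, h3⟩, h4⟩ := key R le_rfl
    rw [← hdet, abs_of_nonneg h, hcard] at h3
    linarith
  -- For det K < 0 the product of all moduli is -det K, so the previous bound is of no use. With a
  -- real eigenvalue t ≤ 0 split off and p the product of the other moduli, det K = tp, and the
  -- claim reduces to (1 - t)(1 - p) ≥ 0.
  · obtain ⟨t, ht0, ht⟩ := exists_nonpos_root_of_det_neg h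
    obtain ⟨S, hS⟩ := Multiset.exists_cons_of_mem ht
    rw [← hR] at hS
    obtain ⟨⟨h1, h2, h3⟩, h4⟩ := key S (hS ▸ Multiset.le_cons_self S t)
    rw [hS] at hcard htr hdet
    simp only [Multiset.map_cons, Multiset.sum_cons, Multiset.prod_cons, Multiset.card_cons,
      Complex.ofReal_re, Complex.norm_real, Real.norm_eq_abs] at hcard htr hdet
    rw [abs_of_neg h, abs_of_nonpos ht0] at hdet
    have hc : (r : ℝ) = S.card + 1 := by exact_mod_cast hcard.symm
    nlinarith

end Contraction

/-! ### Singular value decompositions -/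

section SingularValueDecomposition

open Finset Matrix

variable {r n : ℕ}

theorem singVal_nonneg (X : Matrix (Fin r) (Fin n) ℝ) (i : ℕ) : 0 ≤ singVal X i :=
  LinearMap.singularValues_nonneg _ _

theorem sigmaMin_nonneg (X : Matrix (Fin r) (Fin n) ℝ) : 0 ≤ sigmaMin X :=
  singVal_nonneg X _

theorem sigmaMin_le_singVal (X : Matrix (Fin r) (Fin n) ℝ) (i : Fin r) :
    sigmaMin X ≤ singVal X i :=
  LinearMap.singularValues_antitone _ (by have := i.2; omega)

/-- Singular values depend only on the Gram matrix XᵀX, in which Q cancels. -/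
theorem singVal_mul_of_transpose_mul_eq_one {Q : Matrix (Fin r) (Fin r) ℝ}
    (hQ : Q.transpose * Q = 1) (X : Matrix (Fin r) (Fin n) ℝ) (i : ℕ) :
    singVal (Q * X) i = singVal X i := by
  have h : (Q * X).toEuclideanLin.adjoint ∘ₗ (Q * X).toEuclideanLin =
      X.toEuclideanLin.adjoint ∘ₗ X.toEuclideanLin := by
    rw [← toEuclideanLin_conjTranspose_eq_adjoint, ← toEuclideanLin_conjTranspose_eq_adjoint]
    ext1 x
    simp only [LinearMap.comp_apply, toLpLin_apply, mulVec_mulVec,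
      conjTranspose_eq_transpose_of_trivial, transpose_mul]
    rw [Matrix.mul_assoc, ← Matrix.mul_assoc Q.transpose, hQ, Matrix.one_mul]
  unfold singVal
  have hd : Module.finrank ℝ (EuclideanSpace ℝ (Fin n)) = n := finrank_euclideanSpace_fin
  rcases lt_or_ge i n with hi | hi
  · rw [LinearMap.singularValues_of_lt _ hd hi, LinearMap.singularValues_of_lt _ hd hi]
    congr 1
    simp only [h]
  · rw [LinearMap.singularValues_of_finrank_le _ (hd.trans_le hi),
      LinearMap.singularValues_of_finrank_le _ (hd.trans_le hi)]

theorem of_mul_transpose_eq_one_of_inner {m : ℕ} {f : Fin m → EuclideanSpace ℝ (Fin n)}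
    (hf : ∀ i j, inner ℝ (f i) (f j) = if i = j then (1 : ℝ) else 0) :
    (of fun i j => f i j) * (of fun i j => f i j).transpose = 1 := by
  ext i j
  rw [one_apply, ← hf i j, PiLp.inner_apply]
  simp only [mul_apply, transpose_apply, of_apply]
  exact sum_congr rfl fun k _ => mul_comm (f i k) (f j k)

/-- The operator T of X maps an eigenbasis of T*T to orthogonal vectors of lengths σ_j. The nonzero
images are normalised and completed to an orthonormal basis, giving the columns of U; the rows of V
are the first r eigenvectors. -/
theorem exists_orthogonal_singVal_decomposition (hrn : r ≤ n) (X : Matrix (Fin r) (Fin n) ℝ) :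
    ∃ (U : Matrix (Fin r) (Fin r) ℝ) (V : Matrix (Fin r) (Fin n) ℝ),
      U * U.transpose = 1 ∧ V * V.transpose = 1 ∧
      X = U * diagonal (fun i : Fin r => singVal X i) * V := by
  set T := X.toEuclideanLin with hT
  have hd : Module.finrank ℝ (EuclideanSpace ℝ (Fin n)) = n := finrank_euclideanSpace_fin
  set b := T.isSymmetric_adjoint_comp_self.eigenvectorBasis hd with hb
  have hTb : ∀ i j, inner ℝ (T (b i)) (T (b j)) = if i = j then (singVal X j) ^ 2 else 0 := by
    intro i j
    rw [← LinearMap.adjoint_inner_right]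
    have h1 : T.adjoint (T (b j)) = ((singVal X j) ^ 2) • b j := by
      have := T.isSymmetric_adjoint_comp_self.apply_eigenvectorBasis hd j
      rw [← LinearMap.sq_singularValues_fin] at this
      exact this
    rw [h1, inner_smul_right, b.inner_eq_ite]
    split_ifs <;> simp
  have hzero : ∀ j : Fin n, singVal X j = 0 → T (b j) = 0 := by
    intro j hj
    have := hTb j j
    rw [if_pos rfl, hj, zero_pow two_ne_zero] at this
    exact inner_self_eq_zero.1 this
  -- The rank is at most r, so the eigenvectors left out of V lie in the kernel.
  have hbig : ∀ j : Fin n, r ≤ j → singVal X j = 0 := by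
    intro j hj
    refine LinearMap.singularValues_eq_zero_iff_le_finrank_range _ |>.2 (le_trans ?_ hj)
    exact (Submodule.finrank_le _).trans finrank_euclideanSpace_fin.le
  set c : Fin r → Fin n := Fin.castLE hrn with hc
  set u : Fin r → EuclideanSpace ℝ (Fin r) := fun i => (singVal X i)⁻¹ • T (b (c i)) with hu
  have hon : Orthonormal ℝ (({i | singVal X i ≠ 0} : Set (Fin r)).domRestrict u) := by
    rw [orthonormal_iff_ite]
    rintro ⟨i, hi⟩ ⟨j, hj⟩
    change inner ℝ ((singVal X i)⁻¹ • T (b (c i))) ((singVal X j)⁻¹ • T (b (c j))) = _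
    rw [real_inner_smul_left, real_inner_smul_right, hTb]
    have hj' : singVal X j ≠ 0 := hj
    by_cases h : i = j
    · subst h
      rw [if_pos rfl, if_pos rfl]
      change (singVal X i)⁻¹ * ((singVal X i)⁻¹ * (singVal X i) ^ 2) = 1
      field_simp
    · rw [if_neg (fun h' => h (Fin.castLE_injective hrn h')),
        if_neg (fun h' => h (congrArg Subtype.val h')), mul_zero, mul_zero]
  obtain ⟨e, he⟩ := hon.exists_orthonormalBasis_extension_of_card_eq
    finrank_euclideanSpace
  have hTe : ∀ i : Fin r, T (b (c i)) = singVal X i • e i := by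
    intro i
    by_cases hi : singVal X i = 0
    · rw [hi, zero_smul]
      exact hzero (c i) hi
    · rw [he i hi, hu]
      simp only [smul_smul, mul_inv_cancel₀ hi, one_smul]
  refine ⟨of fun i j => e j i, of fun i j => b (c i) j, ?_, ?_, ?_⟩
  · rw [mul_eq_one_comm]
    exact of_mul_transpose_eq_one_of_inner fun i j => e.inner_eq_ite i j
  · exact of_mul_transpose_eq_one_of_inner fun i j => by
      rw [b.inner_eq_ite]
      simp only [hc, Fin.castLE_inj]
  · apply toEuclideanLin.injective
    refine b.toBasis.ext fun j => ?_
    rw [OrthonormalBasis.coe_toBasis]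
    have hV : (of fun (i : Fin r) j => b (c i) j) *ᵥ (b j).ofLp =
        fun i => if c i = j then 1 else 0 := by
      ext i
      rw [← b.inner_eq_ite (c i) j, PiLp.inner_apply]
      simp only [mulVec, dotProduct, of_apply]
      exact sum_congr rfl fun k _ => mul_comm (b (c i) k) (b j k)
    change T (b j) = WithLp.toLp 2 ((_ * _ * _) *ᵥ (b j).ofLp)
    rw [← mulVec_mulVec, ← mulVec_mulVec, hV]
    rcases lt_or_ge (j : ℕ) r with hj | hj
    · obtain ⟨i, rfl⟩ : ∃ i, c i = j := ⟨⟨j, hj⟩, rfl⟩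
      rw [hTe]
      ext k
      simp [mulVec, dotProduct, diagonal_apply, hc, mul_comm]
    · rw [hzero j (hbig j hj)]
      have : ∀ i, c i ≠ j := by
        rintro i rfl
        exact absurd hj (not_le.2 i.2)
      ext k
      simp [mulVec, dotProduct, this]

/-- The diagonal matrix changing the sign of the `i`-th coordinate. -/
def signFlip (i : Fin r) : Matrix (Fin r) (Fin r) ℝ :=
  diagonal (Function.update (fun _ => 1) i (-1))

theorem det_signFlip (i : Fin r) : (signFlip i).det = -1 := by
  rw [signFlip, det_diagonal, prod_update_of_mem (mem_univ i)]
  simp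

theorem transpose_signFlip (i : Fin r) : (signFlip i).transpose = signFlip i :=
  diagonal_transpose _

theorem signFlip_mul_self (i : Fin r) : signFlip i * signFlip i = 1 := by
  rw [signFlip, diagonal_mul_diagonal, ← diagonal_one]
  congr 1
  ext j
  by_cases h : j = i <;> simp [h]

theorem signFlip_mul_diagonal_mul_signFlip (i : Fin r) (s : Fin r → ℝ) :
    signFlip i * diagonal s * signFlip i = diagonal s := by
  rw [signFlip, diagonal_mul_diagonal, diagonal_mul_diagonal]
  congr 1
  ext j
  by_cases h : j = i <;> simp [h]

theorem det_eq_one_or_neg_one_of_mul_transpose_eq_one {U : Matrix (Fin r) (Fin r) ℝ}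
    (hU : U * U.transpose = 1) : U.det = 1 ∨ U.det = -1 := by
  have := congrArg det hU
  rw [det_mul, det_transpose, det_one] at this
  exact mul_self_eq_one_iff.1 this

theorem mem_specialOrthogonalGroup_of {U : Matrix (Fin r) (Fin r) ℝ}
    (hU : U * U.transpose = 1) (hd : U.det = 1) : U ∈ specialOrthogonalGroup (Fin r) ℝ :=
  mem_specialOrthogonalGroup_iff.2 ⟨(mem_orthogonalGroup_iff (Fin r) ℝ).2 hU, hd⟩

theorem mul_transpose_of_mem_so {U : Matrix (Fin r) (Fin r) ℝ}
    (hU : U ∈ specialOrthogonalGroup (Fin r) ℝ) : U * U.transpose = 1 :=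
  (mem_orthogonalGroup_iff (Fin r) ℝ).1 (mem_specialOrthogonalGroup_iff.1 hU).1

theorem transpose_mul_of_mem_so {U : Matrix (Fin r) (Fin r) ℝ}
    (hU : U ∈ specialOrthogonalGroup (Fin r) ℝ) : U.transpose * U = 1 :=
  (mem_orthogonalGroup_iff' (Fin r) ℝ).1 (mem_specialOrthogonalGroup_iff.1 hU).1

theorem mul_mul_transpose_mul_eq_one {m : ℕ} {A : Matrix (Fin m) (Fin r) ℝ}
    {B : Matrix (Fin r) (Fin n) ℝ} (hA : A * A.transpose = 1) (hB : B * B.transpose = 1) :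
    (A * B) * (A * B).transpose = 1 := by
  rw [transpose_mul, Matrix.mul_assoc, ← Matrix.mul_assoc B, hB, Matrix.one_mul, hA]

theorem exists_isThinSVD (hr : 1 ≤ r) (hrn : r ≤ n) (X : Matrix (Fin r) (Fin n) ℝ) :
    ∃ (U : Matrix (Fin r) (Fin r) ℝ) (V : Matrix (Fin r) (Fin n) ℝ), IsThinSVD X U V := by
  obtain ⟨U, V, hU, hV, hX⟩ := exists_orthogonal_singVal_decomposition hrn X
  rcases det_eq_one_or_neg_one_of_mul_transpose_eq_one hU with h | h
  · exact ⟨U, V, mem_specialOrthogonalGroup_of hU h, hV, hX⟩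
  -- A sign can be moved from U to V, because conjugation by a sign flip fixes diagonal matrices.
  · have hs : signFlip (⟨0, hr⟩ : Fin r) * (signFlip (⟨0, hr⟩ : Fin r)).transpose = 1 := by
      rw [transpose_signFlip, signFlip_mul_self]
    refine ⟨U * signFlip ⟨0, hr⟩, signFlip ⟨0, hr⟩ * V,
      mem_specialOrthogonalGroup_of (mul_mul_transpose_mul_eq_one hU hs) ?_,
      mul_mul_transpose_mul_eq_one hs hV, ?_⟩
    · rw [det_mul, h, det_signFlip]; norm_num
    · conv_lhs => rw [hX, ← signFlip_mul_diagonal_mul_signFlip ⟨0, hr⟩]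
      simp only [Matrix.mul_assoc]

/-- A square matrix has a singular value decomposition with left factor in `SO(r)` and right
factor of determinant `ε = ±1`, whenever the sign of its determinant allows it. -/
theorem exists_svd_of_det_sign (hr : 1 ≤ r) (C : Matrix (Fin r) (Fin r) ℝ) {ε : ℝ}
    (hε : ε = 1 ∨ ε = -1) (hC : 0 ≤ ε * C.det) :
    ∃ (U V : Matrix (Fin r) (Fin r) ℝ) (d : Fin r → ℝ), U ∈ specialOrthogonalGroup (Fin r) ℝ ∧
      V * V.transpose = 1 ∧ V.det = ε ∧ (∀ i, 0 ≤ d i) ∧ C = U * diagonal d * V := by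
  obtain ⟨U, V, hU, hV, hX⟩ := exists_isThinSVD hr le_rfl C
  have hd : ∀ i : Fin r, 0 ≤ singVal C i := fun i => singVal_nonneg C i
  by_cases h : V.det = ε
  · exact ⟨U, V, _, hU, hV, h, hd, hX⟩
  have hVε : V.det = -ε := by
    rcases det_eq_one_or_neg_one_of_mul_transpose_eq_one hV with h1 | h1 <;>
      rcases hε with h2 | h2 <;> grind
  have hdet : C.det = (∏ i : Fin r, singVal C i) * V.det := by
    conv_lhs => rw [hX, det_mul, det_mul, det_diagonal,
      (mem_specialOrthogonalGroup_iff.1 hU).2, one_mul]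
  -- If V has the wrong determinant, the sign hypothesis leaves only det C = 0. A row of V belonging
  -- to a zero singular value can then be negated for free.
  have hprod : ∏ i : Fin r, singVal C i = 0 := by
    have h0 : 0 ≤ ∏ i : Fin r, singVal C i := prod_nonneg fun i _ => hd i
    have : ε * ε = 1 := by rcases hε with rfl | rfl <;> norm_num
    rw [hdet, hVε] at hC
    nlinarith
  obtain ⟨i, -, hi⟩ := prod_eq_zero_iff.1 hprod
  have hs : signFlip i * (signFlip i).transpose = 1 := by
    rw [transpose_signFlip, signFlip_mul_self]
  refine ⟨U, signFlip i * V, _, hU, mul_mul_transpose_mul_eq_one hs hV, ?_, hd, ?_⟩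
  · rw [det_mul, det_signFlip, hVε]; ring
  · have : diagonal (fun i : Fin r => singVal C i) * signFlip i =
        diagonal (fun i : Fin r => singVal C i) := by
      rw [signFlip, diagonal_mul_diagonal]
      congr 1
      ext j
      by_cases h : j = i
      · subst h; simp [hi]
      · simp [h]
    rw [← Matrix.mul_assoc, Matrix.mul_assoc U, this]
    exact hX

end SingularValueDecomposition

/-! ### Frobenius norms and trace inequalities -/

section Frobenius

open Finset Matrix

variable {l m r n : ℕ}

theorem frobenius_norm_sub_sq (X Y : Matrix (Fin r) (Fin n) ℝ) :
    ‖X - Y‖ ^ 2 = ‖X‖ ^ 2 + ‖Y‖ ^ 2 - 2 * (Y.transpose * X).trace := by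
  simp only [frobenius_norm_sq, transpose_sub, Matrix.sub_mul, Matrix.mul_sub, trace_sub]
  have : (X.transpose * Y).trace = (Y.transpose * X).trace := by
    rw [← trace_transpose, transpose_mul, transpose_transpose]
  rw [this]; ring

theorem frobenius_norm_orthogonal_mul {P : Matrix (Fin m) (Fin r) ℝ}
    (hP : P.transpose * P = 1) (Z : Matrix (Fin r) (Fin n) ℝ) : ‖P * Z‖ = ‖Z‖ := by
  rw [← sq_eq_sq₀ (norm_nonneg _) (norm_nonneg _), frobenius_norm_sq, frobenius_norm_sq,
    transpose_mul, Matrix.mul_assoc, ← Matrix.mul_assoc P.transpose, hP, Matrix.one_mul]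

theorem frobenius_norm_mul_orthogonal {V : Matrix (Fin r) (Fin n) ℝ}
    (hV : V * V.transpose = 1) (Z : Matrix (Fin m) (Fin r) ℝ) : ‖Z * V‖ = ‖Z‖ := by
  rw [← sq_eq_sq₀ (norm_nonneg _) (norm_nonneg _), frobenius_norm_sq, frobenius_norm_sq,
    transpose_mul, Matrix.mul_assoc, trace_mul_comm, Matrix.mul_assoc, Matrix.mul_assoc, hV,
    Matrix.mul_one]

theorem frobenius_norm_diagonal_sq (s : Fin r → ℝ) : ‖diagonal s‖ ^ 2 = ∑ i, s i ^ 2 := by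
  rw [frobenius_norm_sq, diagonal_transpose, diagonal_mul_diagonal, trace_diagonal]
  exact sum_congr rfl fun i _ => (sq (s i)).symm

theorem frobenius_norm_svd_sq {U : Matrix (Fin m) (Fin r) ℝ} {V : Matrix (Fin r) (Fin n) ℝ}
    (hU : U.transpose * U = 1) (hV : V * V.transpose = 1) (s : Fin r → ℝ) :
    ‖U * diagonal s * V‖ ^ 2 = ∑ i, s i ^ 2 := by
  rw [frobenius_norm_mul_orthogonal hV, frobenius_norm_orthogonal_mul hU,
    frobenius_norm_diagonal_sq]

theorem frobenius_norm_sq_eq_sum (Z : Matrix (Fin r) (Fin n) ℝ) :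
    ‖Z‖ ^ 2 = ∑ j, ∑ i, Z i j ^ 2 := by
  rw [frobenius_norm_sq]
  simp only [trace, diag_apply, mul_apply, transpose_apply, sq]

theorem mul_frobenius_norm_le_norm_diagonal_mul {a : ℝ} (ha : 0 ≤ a) {s : Fin r → ℝ}
    (hs : ∀ i, a ≤ s i) (Z : Matrix (Fin r) (Fin n) ℝ) : a * ‖Z‖ ≤ ‖diagonal s * Z‖ := by
  rw [← sq_le_sq₀ (by positivity) (norm_nonneg _), mul_pow, frobenius_norm_sq_eq_sum,
    frobenius_norm_sq_eq_sum, mul_sum]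
  refine sum_le_sum fun j _ => ?_
  rw [mul_sum]
  refine sum_le_sum fun i _ => ?_
  rw [diagonal_mul, mul_pow]
  have := hs i
  gcongr

/-- Vectors are treated as r × 1 matrices, so that Frobenius norms and their submultiplicativity
also handle the action of a matrix on a vector. -/
theorem frobenius_norm_diagonal_mul_single (s : Fin r → ℝ) (i : Fin r) :
    ‖diagonal s * single i (0 : Fin 1) (1 : ℝ)‖ = |s i| := by
  rw [← sq_eq_sq₀ (norm_nonneg _) (abs_nonneg _), frobenius_norm_sq_eq_sum, sq_abs]
  simp [diagonal_mul, single_apply]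

theorem frobenius_norm_single_one (i : Fin r) : ‖single i (0 : Fin 1) (1 : ℝ)‖ = 1 := by
  have := frobenius_norm_diagonal_mul_single (fun _ => 1) i
  rwa [diagonal_one, Matrix.one_mul, abs_one] at this

/-- Weyl's inequality for the smallest singular value. -/
theorem sub_le_frobenius_norm_sub {P₁ P₂ P₃ P₄ : Matrix (Fin r) (Fin r) ℝ}
    (h₁ : P₁.transpose * P₁ = 1) (h₂ : P₂.transpose * P₂ = 1) (h₃ : P₃.transpose * P₃ = 1)
    (h₄ : P₄ * P₄.transpose = 1) {a : ℝ} (ha : 0 ≤ a) {s t : Fin r → ℝ} (hs : ∀ i, a ≤ s i)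
    (i : Fin r) (ht : 0 ≤ t i) :
    a - t i ≤ ‖P₁ * diagonal s * P₂ - P₃ * diagonal t * P₄‖ := by
  -- This unit vector is the i-th right singular vector of the second matrix, which scales it by t
  -- i, while the first matrix scales it by at least a.
  set c : Matrix (Fin r) (Fin 1) ℝ := P₄.transpose * single i (0 : Fin 1) (1 : ℝ) with hc
  have hcn : ‖c‖ = 1 := by
    rw [hc, frobenius_norm_orthogonal_mul (by rwa [transpose_transpose]),
      frobenius_norm_single_one]
  have hA : a ≤ ‖P₁ * diagonal s * P₂ * c‖ := by
    rw [Matrix.mul_assoc, Matrix.mul_assoc, frobenius_norm_orthogonal_mul h₁]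
    refine le_trans ?_ (mul_frobenius_norm_le_norm_diagonal_mul ha hs _)
    rw [frobenius_norm_orthogonal_mul h₂, hcn, mul_one]
  have hB : ‖P₃ * diagonal t * P₄ * c‖ = t i := by
    rw [hc, Matrix.mul_assoc, ← Matrix.mul_assoc P₄, h₄, Matrix.one_mul, Matrix.mul_assoc,
      frobenius_norm_orthogonal_mul h₃, frobenius_norm_diagonal_mul_single, abs_of_nonneg ht]
  calc a - t i ≤ ‖P₁ * diagonal s * P₂ * c‖ - ‖P₃ * diagonal t * P₄ * c‖ := by
        rw [hB]; linarith
    _ ≤ ‖P₁ * diagonal s * P₂ * c - P₃ * diagonal t * P₄ * c‖ := norm_sub_norm_le _ _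
    _ = ‖(P₁ * diagonal s * P₂ - P₃ * diagonal t * P₄) * c‖ := by rw [Matrix.sub_mul]
    _ ≤ ‖P₁ * diagonal s * P₂ - P₃ * diagonal t * P₄‖ * ‖c‖ := frobenius_norm_mul _ _
    _ = _ := by rw [hcn, mul_one]

theorem trace_diagonal_mul (d : Fin r → ℝ) (K : Matrix (Fin r) (Fin r) ℝ) :
    (diagonal d * K).trace = ∑ i, d i * K i i := by
  simp [trace]

theorem IsContraction.trace_diagonal_mul_le {K : Matrix (Fin r) (Fin r) ℝ} (hK : IsContraction K)
    {d : Fin r → ℝ} (hd : ∀ i, 0 ≤ d i) : (diagonal d * K).trace ≤ ∑ i, d i := by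
  rw [trace_diagonal_mul]
  exact sum_le_sum fun i _ => mul_le_of_le_one_right (hd i) (hK.diag_le_one i)

/-- Since 1 - K i i ≥ 0, lowering every weight d i to c only decreases ∑ d i (1 - K i i);
`IsContraction.trace_le` bounds what remains. -/
theorem IsContraction.trace_diagonal_mul_le_sub {K : Matrix (Fin r) (Fin r) ℝ}
    (hK : IsContraction K) {c : ℝ} (hc : 0 ≤ c) {d : Fin r → ℝ} (hd : ∀ i, c ≤ d i) :
    (diagonal d * K).trace ≤ ∑ i, d i - c * (1 - K.det) := by
  have h1 : c * ∑ i, (1 - K i i) ≤ ∑ i, d i * (1 - K i i) := by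
    rw [mul_sum]
    exact sum_le_sum fun i _ =>
      mul_le_mul_of_nonneg_right (hd i) (sub_nonneg.2 (hK.diag_le_one i))
  have h2 : ∑ i, (1 - K i i) = r - K.trace := by
    rw [sum_sub_distrib]; simp [trace]
  have h3 : ∑ i, d i * (1 - K i i) = ∑ i, d i - (diagonal d * K).trace := by
    rw [trace_diagonal_mul, ← sum_sub_distrib]
    exact sum_congr rfl fun i _ => by ring
  have h4 := mul_le_mul_of_nonneg_left hK.trace_le hc
  rw [h2, h3] at h1
  linarith

end Frobenius

/-! ### Metric estimates for the Gram square root and the Plücker component -/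

section Invariants

open Finset Matrix

variable {r n : ℕ} {X Y : Matrix (Fin r) (Fin n) ℝ} {Ux Uy : Matrix (Fin r) (Fin r) ℝ}
  {Vx Vy : Matrix (Fin r) (Fin n) ℝ}

theorem IsThinSVD.norm_sq (hX : IsThinSVD X Ux Vx) : ‖X‖ ^ 2 = ∑ i : Fin r, singVal X i ^ 2 := by
  conv_lhs => rw [hX.eq_mul]
  exact frobenius_norm_svd_sq (transpose_mul_of_mem_so hX.mem_so) hX.mul_transpose _

theorem norm_plucker_of_mul_transpose {V : Matrix (Fin r) (Fin n) ℝ} (hV : V * V.transpose = 1) :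
    ‖plucker V‖ = 1 := by
  rw [← sq_eq_sq₀ (norm_nonneg _) zero_le_one, ← real_inner_self_eq_norm_sq, inner_plucker, hV,
    det_one, one_pow]

theorem norm_smul_plucker_sub_sq (hX : IsThinSVD X Ux Vx) (hY : IsThinSVD Y Uy Vy) :
    ‖sigmaMin X • plucker Vx - sigmaMin Y • plucker Vy‖ ^ 2 =
      sigmaMin X ^ 2 + sigmaMin Y ^ 2 -
        2 * (sigmaMin X * sigmaMin Y) * (Vx * Vy.transpose).det := by
  rw [norm_sub_sq_real, norm_smul, norm_smul, norm_plucker_of_mul_transpose hX.mul_transpose,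
    norm_plucker_of_mul_transpose hY.mul_transpose, real_inner_smul_left, real_inner_smul_right,
    inner_plucker, mul_one, mul_one, Real.norm_eq_abs, Real.norm_eq_abs, sq_abs, sq_abs]
  ring

/-- The map `X ↦ σ_min(X) Plü(V_X)` is `1`-Lipschitz. -/
theorem norm_smul_plucker_sub_le (hr : 1 ≤ r) (hX : IsThinSVD X Ux Vx) (hY : IsThinSVD Y Uy Vy) :
    ‖sigmaMin X • plucker Vx - sigmaMin Y • plucker Vy‖ ^ 2 ≤ ‖X - Y‖ ^ 2 := by
  set s : Fin r → ℝ := fun i => singVal X i with hs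
  set t : Fin r → ℝ := fun i => singVal Y i with ht
  set a := sigmaMin X with ha
  set b := sigmaMin Y with hb
  have ha0 : 0 ≤ a := sigmaMin_nonneg X
  have hb0 : 0 ≤ b := sigmaMin_nonneg Y
  have has : ∀ i, a ≤ s i := sigmaMin_le_singVal X
  have hbt : ∀ i, b ≤ t i := sigmaMin_le_singVal Y
  set C := diagonal t * (Uy.transpose * Ux) * diagonal s with hC
  have hUx := hX.mem_so
  have hUy := hY.mem_so
  have hdetC : 0 ≤ (1 : ℝ) * C.det := by
    rw [one_mul, hC, det_mul, det_mul, det_mul, det_transpose,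
      (mem_specialOrthogonalGroup_iff.1 hUx).2, (mem_specialOrthogonalGroup_iff.1 hUy).2,
      det_diagonal, det_diagonal, mul_one, mul_one]
    exact mul_nonneg (prod_nonneg fun i _ => hb0.trans (hbt i))
      (prod_nonneg fun i _ => ha0.trans (has i))
  -- Both outer factors have determinant 1, so that K = VNU has the same determinant as N. The cross
  -- term tr(YᵀX) = tr(CN) becomes tr(diag(d) K).
  obtain ⟨U, V, d, hU, hV, hVdet, hd0, hUV⟩ := exists_svd_of_det_sign hr C (Or.inl rfl) hdetC
  have hU' := transpose_mul_of_mem_so hU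
  have hW : (Uy.transpose * Ux).transpose * (Uy.transpose * Ux) = 1 := by
    rw [transpose_mul, transpose_transpose, Matrix.mul_assoc, ← Matrix.mul_assoc Uy,
      mul_transpose_of_mem_so hUy, Matrix.one_mul, transpose_mul_of_mem_so hUx]
  -- The i-th right singular vector of C is stretched by at least a, rotated, and stretched by at
  -- least b.
  have hd : ∀ i, b * a ≤ d i := by
    intro i
    have h1 : ‖C * (V.transpose * single i (0 : Fin 1) (1 : ℝ))‖ = d i := by
      rw [hUV, Matrix.mul_assoc, ← Matrix.mul_assoc V, hV, Matrix.one_mul, Matrix.mul_assoc,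
        frobenius_norm_orthogonal_mul hU', frobenius_norm_diagonal_mul_single,
        abs_of_nonneg (hd0 i)]
    have h2 : ‖V.transpose * single i (0 : Fin 1) (1 : ℝ)‖ = 1 := by
      rw [frobenius_norm_orthogonal_mul (by rwa [transpose_transpose]), frobenius_norm_single_one]
    rw [← h1, hC, Matrix.mul_assoc, Matrix.mul_assoc]
    refine le_trans ?_ (mul_frobenius_norm_le_norm_diagonal_mul hb0 hbt _)
    rw [frobenius_norm_orthogonal_mul hW]
    refine mul_le_mul_of_nonneg_left ?_ hb0
    refine le_trans ?_ (mul_frobenius_norm_le_norm_diagonal_mul ha0 has _)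
    rw [h2, mul_one]
  set N := Vx * Vy.transpose with hN
  have hK : IsContraction (V * N * U) := by
    have : V * N * U = (V * Vx) * (U.transpose * Vy).transpose := by
      simp only [hN, transpose_mul, transpose_transpose, Matrix.mul_assoc]
    rw [this]
    exact isContraction_mul_transpose (mul_mul_transpose_mul_eq_one hV hX.mul_transpose)
      (mul_mul_transpose_mul_eq_one (by rwa [transpose_transpose]) hY.mul_transpose)
  have hKdet : (V * N * U).det = N.det := by
    rw [det_mul, det_mul, hVdet, (mem_specialOrthogonalGroup_iff.1 hU).2, one_mul, mul_one]
  have hmain := hK.trace_diagonal_mul_le_sub (mul_nonneg hb0 ha0) hd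
  rw [hKdet] at hmain
  have htr : (Y.transpose * X).trace = (diagonal d * (V * N * U)).trace := by
    have h1 : (Y.transpose * X).trace = (C * N).trace := by
      rw [hX.eq_mul, hY.eq_mul, transpose_mul, transpose_mul, diagonal_transpose, Matrix.mul_assoc,
        trace_mul_comm]
      simp only [hC, hN, hs, ht, Matrix.mul_assoc]
    rw [h1, hUV, Matrix.mul_assoc, Matrix.mul_assoc, trace_mul_comm]
    simp only [Matrix.mul_assoc]
  -- The quantity ∑ s² + ∑ t² - 2 ∑ d is itself a squared distance between matrices with singular
  -- values s and t, so Weyl's inequality bounds it below by (a - b)². Adding 2ab(1 - det N) gives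
  -- exactly the Plücker distance a² + b² - 2ab det N.
  have hsum : ‖Ux * diagonal s * V.transpose - Uy * diagonal t * U‖ ^ 2 =
      ∑ i, s i ^ 2 + ∑ i, t i ^ 2 - 2 * ∑ i, d i := by
    rw [frobenius_norm_sub_sq, frobenius_norm_svd_sq (transpose_mul_of_mem_so hUx)
      (by rwa [transpose_transpose, mul_eq_one_comm]),
      frobenius_norm_svd_sq (transpose_mul_of_mem_so hUy) (mul_transpose_of_mem_so hU)]
    have h1 : (Uy * diagonal t * U).transpose * (Ux * diagonal s * V.transpose) =
        U.transpose * (C * V.transpose) := by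
      simp only [hC, transpose_mul, diagonal_transpose, Matrix.mul_assoc]
    rw [h1, hUV, Matrix.mul_assoc (U * diagonal d), hV, Matrix.mul_one, ← Matrix.mul_assoc, hU',
      Matrix.one_mul, trace_diagonal]
  have hweyl : (a - b) ^ 2 ≤ ‖Ux * diagonal s * V.transpose - Uy * diagonal t * U‖ ^ 2 := by
    have hlast : r - 1 < r := by omega
    have h1 := sub_le_frobenius_norm_sub (P₂ := V.transpose) (transpose_mul_of_mem_so hUx)
      (by rwa [transpose_transpose]) (transpose_mul_of_mem_so hUy) (mul_transpose_of_mem_so hU)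
      ha0 has (t := t) ⟨r - 1, hlast⟩ (hb0.trans (hbt _))
    have h2 := sub_le_frobenius_norm_sub (P₄ := V.transpose) (transpose_mul_of_mem_so hUy) hU'
      (transpose_mul_of_mem_so hUx) (by rwa [transpose_transpose, mul_eq_one_comm])
      hb0 hbt (t := s) ⟨r - 1, hlast⟩ (ha0.trans (has _))
    rw [norm_sub_rev] at h2
    change a - b ≤ _ at h1
    change b - a ≤ _ at h2
    refine sq_le_sq' ?_ h1
    linarith
  rw [norm_smul_plucker_sub_sq hX hY, frobenius_norm_sub_sq, hX.norm_sq, hY.norm_sq, htr]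
  rw [hsum] at hweyl
  change _ ≤ ∑ i, s i ^ 2 + ∑ i, t i ^ 2 - _
  linarith

theorem IsThinSVD.gramSqrt_eq (hX : IsThinSVD X Ux Vx) :
    gramSqrt X = Vx.transpose * diagonal (fun i : Fin r => singVal X i) * Vx := by
  have hpos : (diagonal (fun i : Fin r => singVal X i)).PosSemidef :=
    PosSemidef.diagonal fun i => singVal_nonneg X i
  unfold gramSqrt
  refine CFC.sqrt_unique ?_ ?_
  · conv_rhs => rw [hX.eq_mul]
    rw [transpose_mul, transpose_mul, diagonal_transpose]
    have h1 := hX.mul_transpose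
    have h2 := transpose_mul_of_mem_so hX.mem_so
    simp only [Matrix.mul_assoc]
    rw [← Matrix.mul_assoc Vx, h1, Matrix.one_mul, ← Matrix.mul_assoc Ux.transpose, h2,
      Matrix.one_mul]
  · rw [nonneg_iff_posSemidef]
    have := hpos.conjTranspose_mul_mul_same Vx
    rwa [conjTranspose_eq_transpose_of_trivial] at this

theorem IsThinSVD.norm_gramSqrt_sq (hX : IsThinSVD X Ux Vx) :
    ‖gramSqrt X‖ ^ 2 = ∑ i : Fin r, singVal X i ^ 2 := by
  rw [hX.gramSqrt_eq]
  exact frobenius_norm_svd_sq (by rw [transpose_transpose]; exact hX.mul_transpose)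
    hX.mul_transpose _

theorem trace_gramSqrt_mul (hX : IsThinSVD X Ux Vx) (hY : IsThinSVD Y Uy Vy) :
    ((gramSqrt Y).transpose * gramSqrt X).trace =
      (diagonal (fun i : Fin r => singVal X i) * (Vx * Vy.transpose) *
        diagonal (fun i : Fin r => singVal Y i) * (Vx * Vy.transpose).transpose).trace := by
  rw [hX.gramSqrt_eq, hY.gramSqrt_eq]
  simp only [transpose_mul, diagonal_transpose, transpose_transpose]
  rw [trace_mul_comm]
  simp only [Matrix.mul_assoc]
  rw [trace_mul_comm]
  simp only [Matrix.mul_assoc]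

theorem trace_diagonal_mul_mul_diagonal_mul_transpose (s t : Fin r → ℝ)
    (A B : Matrix (Fin r) (Fin r) ℝ) :
    (diagonal s * A * diagonal t * B.transpose).trace = ∑ i, ∑ j, s i * t j * (A i j * B i j) := by
  simp only [trace, diag_apply]
  refine sum_congr rfl fun i _ => ?_
  rw [mul_apply]
  refine sum_congr rfl fun j _ => ?_
  rw [mul_diagonal, diagonal_mul, transpose_apply]
  ring

theorem sum_row_sq_of_mul_transpose {B : Matrix (Fin r) (Fin r) ℝ} (hB : B * B.transpose = 1)
    (i : Fin r) : ∑ j, B i j ^ 2 = 1 := by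
  have := congrFun (congrFun hB i) i
  rw [mul_apply, one_apply_eq] at this
  rw [← this]
  exact sum_congr rfl fun j _ => sq _

/-- The Araki–Yamagami inequality `‖|X| - |Y|‖ ≤ √2 ‖X - Y‖`. -/
theorem norm_gramSqrt_sub_sq_le (hX : IsThinSVD X Ux Vx) (hY : IsThinSVD Y Uy Vy) :
    ‖gramSqrt X - gramSqrt Y‖ ^ 2 ≤ 2 * ‖X - Y‖ ^ 2 := by
  set s : Fin r → ℝ := fun i => singVal X i with hs
  set t : Fin r → ℝ := fun i => singVal Y i with ht
  set N := Vx * Vy.transpose with hN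
  set B := Ux.transpose * Uy with hB
  have hUx := hX.mem_so
  have hUy := hY.mem_so
  have hB1 : B * B.transpose = 1 := by
    refine mul_mul_transpose_mul_eq_one ?_ (mul_transpose_of_mem_so hUy)
    rw [transpose_transpose, transpose_mul_of_mem_so hUx]
  have hB2 : B.transpose * B.transpose.transpose = 1 := by
    rw [transpose_transpose, mul_eq_one_comm, hB1]
  have htr : (Y.transpose * X).trace = ∑ i, ∑ j, s i * t j * (N i j * B i j) := by
    rw [← trace_diagonal_mul_mul_diagonal_mul_transpose, hX.eq_mul, hY.eq_mul, transpose_mul,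
      transpose_mul, diagonal_transpose, Matrix.mul_assoc, trace_mul_comm]
    simp only [hN, hB, transpose_mul, transpose_transpose, Matrix.mul_assoc]
    rw [trace_mul_comm]
    simp only [Matrix.mul_assoc]
    rw [trace_mul_comm]
    simp only [Matrix.mul_assoc]
    rw [trace_mul_comm]
    simp only [Matrix.mul_assoc, hs, ht]
  -- B is orthogonal, so the squares of its entries are doubly stochastic. This turns the claim into
  -- an entrywise inequality.
  have hS : ∑ i, s i ^ 2 = ∑ i, ∑ j, B i j ^ 2 * s i ^ 2 := by
    refine sum_congr rfl fun i _ => ?_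
    rw [← sum_mul, sum_row_sq_of_mul_transpose hB1, one_mul]
  have hT : ∑ j, t j ^ 2 = ∑ i, ∑ j, B i j ^ 2 * t j ^ 2 := by
    rw [sum_comm]
    refine sum_congr rfl fun j _ => ?_
    rw [← sum_mul]
    have := sum_row_sq_of_mul_transpose hB2 j
    simp only [transpose_apply] at this
    rw [this, one_mul]
  have hkey : 0 ≤ (∑ i, s i ^ 2) + (∑ j, t j ^ 2) - 4 * (∑ i, ∑ j, s i * t j * (N i j * B i j)) +
      2 * ∑ i, ∑ j, s i * t j * (N i j * N i j) := by
    rw [hS, hT]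
    simp only [mul_sum, ← sum_add_distrib, ← sum_sub_distrib]
    refine sum_nonneg fun i _ => sum_nonneg fun j _ => ?_
    -- Each summand equals B²(s - t)² + 2st(B - N)².
    have h1 : 0 ≤ s i * t j := mul_nonneg (singVal_nonneg _ _) (singVal_nonneg _ _)
    have h2 := mul_nonneg h1 (sq_nonneg (B i j - N i j))
    have h3 := mul_nonneg (sq_nonneg (B i j)) (sq_nonneg (s i - t j))
    nlinarith
  rw [frobenius_norm_sub_sq, frobenius_norm_sub_sq, hX.norm_sq, hY.norm_sq, hX.norm_gramSqrt_sq,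
    hY.norm_gramSqrt_sq, trace_gramSqrt_mul hX hY, trace_diagonal_mul_mul_diagonal_mul_transpose,
    htr]
  linarith

/-- After a rotation or a reflection, `X` and `Y` are at most as far apart as `φ(X)` and `φ(Y)`. -/
theorem exists_orthogonal_norm_sub_mul_le (hr : 1 ≤ r) (hX : IsThinSVD X Ux Vx)
    (hY : IsThinSVD Y Uy Vy) {ε : ℝ} (hε : ε = 1 ∨ ε = -1)
    (hdet : 0 ≤ ε * (Vx * Vy.transpose).det) :
    ∃ Q : Matrix (Fin r) (Fin r) ℝ, Q * Q.transpose = 1 ∧ Q.det = ε ∧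
      ‖X - Q * Y‖ ≤ ‖gramSqrt X - gramSqrt Y‖ := by
  set s : Fin r → ℝ := fun i => singVal X i with hs
  set t : Fin r → ℝ := fun i => singVal Y i with ht
  set N := Vx * Vy.transpose with hN
  set C := diagonal t * N.transpose * diagonal s with hC
  have hUx := hX.mem_so
  have hUy := hY.mem_so
  have hdetC : 0 ≤ ε * C.det := by
    rw [hC, det_mul, det_mul, det_transpose, det_diagonal, det_diagonal]
    have h1 : 0 ≤ ∏ i, t i := prod_nonneg fun i _ => singVal_nonneg Y i
    have h2 : 0 ≤ ∏ i, s i := prod_nonneg fun i _ => singVal_nonneg X i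
    calc 0 ≤ (∏ i, t i) * (∏ i, s i) * (ε * N.det) := by positivity
      _ = _ := by ring
  obtain ⟨U, V, d, hU, hV, hVdet, hd0, hUV⟩ := exists_svd_of_det_sign hr C hε hdetC
  have hU' := transpose_mul_of_mem_so hU
  have hV' : V.transpose * V = 1 := mul_eq_one_comm.1 hV
  have hQ : (Ux * (V.transpose * U.transpose) * Uy.transpose) *
      (Ux * (V.transpose * U.transpose) * Uy.transpose).transpose = 1 := by
    refine mul_mul_transpose_mul_eq_one (mul_mul_transpose_mul_eq_one
      (mul_transpose_of_mem_so hUx) (mul_mul_transpose_mul_eq_one ?_ ?_)) ?_ <;>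
    rw [transpose_transpose]
    · exact hV'
    · exact hU'
    · exact transpose_mul_of_mem_so hUy
  -- Procrustes: XYᵀ = (Ux Vᵀ) diag(d) (Uy U)ᵀ, and Q is the product of its outer factors. Then
  -- tr((QY)ᵀX) = ∑ d, whereas the cross term of φ(X) and φ(Y) is tr(diag(d) VNU) ≤ ∑ d.
  refine ⟨Ux * (V.transpose * U.transpose) * Uy.transpose, hQ, ?_, ?_⟩
  · rw [det_mul, det_mul, det_mul, det_transpose, det_transpose, det_transpose, hVdet,
      (mem_specialOrthogonalGroup_iff.1 hU).2, (mem_specialOrthogonalGroup_iff.1 hUx).2,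
      (mem_specialOrthogonalGroup_iff.1 hUy).2]
    ring
  have hK : IsContraction (V * N * U) := by
    have : V * N * U = (V * Vx) * (U.transpose * Vy).transpose := by
      simp only [hN, transpose_mul, transpose_transpose, Matrix.mul_assoc]
    rw [this]
    exact isContraction_mul_transpose (mul_mul_transpose_mul_eq_one hV hX.mul_transpose)
      (mul_mul_transpose_mul_eq_one (by rwa [transpose_transpose]) hY.mul_transpose)
  have hmain := hK.trace_diagonal_mul_le hd0
  have htr1 : ((gramSqrt Y).transpose * gramSqrt X).trace = (diagonal d * (V * N * U)).trace := by
    rw [trace_gramSqrt_mul hX hY]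
    have h1 : (diagonal s * N * diagonal t * N.transpose).trace = (C * N).trace := by
      rw [hC, Matrix.mul_assoc, trace_mul_comm]
      simp only [Matrix.mul_assoc]
    rw [h1, hUV, Matrix.mul_assoc, Matrix.mul_assoc, trace_mul_comm]
    simp only [Matrix.mul_assoc]
  have htr2 : ((Ux * (V.transpose * U.transpose) * Uy.transpose * Y).transpose * X).trace =
      ∑ i, d i := by
    have h1 : Ux * (V.transpose * U.transpose) * Uy.transpose * Y =
        Ux * (V.transpose * U.transpose) * (diagonal t * Vy) := by
      conv_lhs => rw [hY.eq_mul]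
      simp only [Matrix.mul_assoc]
      rw [← Matrix.mul_assoc Uy.transpose, transpose_mul_of_mem_so hUy, Matrix.one_mul]
    have h2 : (Ux * (V.transpose * U.transpose) * (diagonal t * Vy)).transpose * X =
        Vy.transpose * (diagonal t * (U * (V * (diagonal s * Vx)))) := by
      conv_lhs => rw [hX.eq_mul]
      simp only [transpose_mul, transpose_transpose, diagonal_transpose, Matrix.mul_assoc]
      rw [← Matrix.mul_assoc Ux.transpose, transpose_mul_of_mem_so hUx, Matrix.one_mul]
    rw [h1, h2, ← trace_diagonal d]
    have h3 : (Vy.transpose * (diagonal t * (U * (V * (diagonal s * Vx))))).trace =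
        (U * V * C.transpose).trace := by
      rw [trace_mul_comm]
      simp only [Matrix.mul_assoc]
      rw [trace_mul_comm]
      simp only [hC, hN, transpose_mul, transpose_transpose, diagonal_transpose, Matrix.mul_assoc]
    rw [h3, hUV]
    simp only [transpose_mul, diagonal_transpose, Matrix.mul_assoc]
    rw [← Matrix.mul_assoc V, hV, Matrix.one_mul, trace_mul_comm, Matrix.mul_assoc, hU',
      Matrix.mul_one]
  rw [← sq_le_sq₀ (norm_nonneg _) (norm_nonneg _), frobenius_norm_sub_sq, frobenius_norm_sub_sq,
    htr1, htr2, hX.norm_gramSqrt_sq, hY.norm_gramSqrt_sq,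
    frobenius_norm_orthogonal_mul (mul_eq_one_comm.1 hQ), hX.norm_sq, hY.norm_sq]
  linarith

/-- Reflecting the smallest singular direction of `X` moves `X` by `2 σ_min(X)`. -/
theorem IsThinSVD.exists_reflection (hr : 1 ≤ r) (hX : IsThinSVD X Ux Vx) :
    ∃ R : Matrix (Fin r) (Fin r) ℝ, R * R.transpose = 1 ∧ R.det = -1 ∧
      ‖X - R * X‖ ≤ 2 * sigmaMin X := by
  have hUx := hX.mem_so
  set i : Fin r := ⟨r - 1, by omega⟩ with hi
  set s : Fin r → ℝ := fun i => singVal X i with hs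
  have hself : Ux * signFlip i * Ux.transpose * (Ux * signFlip i * Ux.transpose) = 1 := by
    simp only [Matrix.mul_assoc]
    rw [← Matrix.mul_assoc Ux.transpose, transpose_mul_of_mem_so hUx, Matrix.one_mul,
      ← Matrix.mul_assoc (signFlip i), signFlip_mul_self, Matrix.one_mul,
      mul_transpose_of_mem_so hUx]
  refine ⟨Ux * signFlip i * Ux.transpose, ?_, ?_, ?_⟩
  · have : (Ux * signFlip i * Ux.transpose).transpose = Ux * signFlip i * Ux.transpose := by
      simp only [transpose_mul, transpose_transpose, transpose_signFlip, Matrix.mul_assoc]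
    rw [this, hself]
  · rw [det_mul, det_mul, det_transpose, det_signFlip, (mem_specialOrthogonalGroup_iff.1 hUx).2]
    norm_num
  · have h1 : X - Ux * signFlip i * Ux.transpose * X =
        Ux * diagonal (Function.update 0 i (2 * sigmaMin X)) * Vx := by
      have h2 : Ux * signFlip i * Ux.transpose * X = Ux * (signFlip i * diagonal s) * Vx := by
        conv_lhs => rw [hX.eq_mul]
        simp only [Matrix.mul_assoc]
        rw [← Matrix.mul_assoc Ux.transpose, transpose_mul_of_mem_so hUx, Matrix.one_mul]
      rw [h2]
      conv_lhs => rw [hX.eq_mul]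
      rw [← Matrix.sub_mul, ← Matrix.mul_sub, signFlip, diagonal_mul_diagonal, diagonal_sub]
      congr 3
      ext j
      by_cases h : j = i
      · subst h
        simp [hs, sigmaMin, hi]
        ring
      · simp [h, hs]
    rw [h1, ← sq_le_sq₀ (norm_nonneg _) (by have := sigmaMin_nonneg X; positivity),
      frobenius_norm_svd_sq (transpose_mul_of_mem_so hUx) hX.mul_transpose,
      sum_eq_single i (by intro j _ hj; simp [hj]) (by simp), Function.update_self]

end Invariants

/-! ### Distortion in terms of real constants -/

section DistortionBounds

variable {X : Type u} {Y : Type w} [MetricSpace X] [MetricSpace Y] {f : X → Y}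

theorem distortion_le_of_bounds {α β : ℝ} (hα : 0 < α)
    (h1 : ∀ x y, α * dist x y ≤ dist (f x) (f y)) (h2 : ∀ x y, dist (f x) (f y) ≤ β * dist x y) :
    distortion f ≤ ENNReal.ofReal (β / α) := by
  have hl : ENNReal.ofReal α ≤ lowerLipschitzBound f := by
    refine le_sSup fun x y => ?_
    rw [edist_dist, edist_dist, ← ENNReal.ofReal_mul hα.le]
    exact ENNReal.ofReal_le_ofReal (h1 x y)
  have hu : upperLipschitzBound f ≤ ENNReal.ofReal β := by
    refine sInf_le fun x y => ?_
    rw [edist_dist, edist_dist, ← ENNReal.ofReal_mul' dist_nonneg]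
    exact ENNReal.ofReal_le_ofReal (h2 x y)
  have hl0 : lowerLipschitzBound f ≠ 0 := ((ENNReal.ofReal_pos.2 hα).trans_le hl).ne'
  have hu0 : upperLipschitzBound f ≠ ∞ := (hu.trans_lt ENNReal.ofReal_lt_top).ne
  rw [distortion, if_neg (not_or.2 ⟨hl0, hu0⟩), ENNReal.ofReal_div_of_pos hα]
  exact ENNReal.div_le_div hu hl

theorem lowerLipschitzBound_mul_edist_le (x y : X) :
    lowerLipschitzBound f * edist x y ≤ edist (f x) (f y) := by
  rw [lowerLipschitzBound, ENNReal.sSup_mul]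
  exact iSup₂_le fun α hα => hα x y

theorem edist_le_upperLipschitzBound_mul (x y : X) :
    edist (f x) (f y) ≤ upperLipschitzBound f * edist x y := by
  rcases eq_or_ne x y with rfl | h
  · simp
  · rw [← ENNReal.div_le_iff (edist_pos.2 h).ne' (edist_ne_top x y)]
    exact le_sInf fun β hβ =>
      (ENNReal.div_le_iff (edist_pos.2 h).ne' (edist_ne_top x y)).2 (hβ x y)

/-- Two distinct points force the optimal lower bound to be finite, hence a real number; on a
one-point space it would be ∞. -/
theorem exists_bounds_of_distortion_ne_top [Nontrivial X] (hf : distortion f ≠ ∞) :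
    ∃ α β : ℝ, 0 < α ∧ (∀ x y, α * dist x y ≤ dist (f x) (f y)) ∧
      (∀ x y, dist (f x) (f y) ≤ β * dist x y) ∧ distortion f = ENNReal.ofReal (β / α) := by
  have h0 : ¬(lowerLipschitzBound f = 0 ∨ upperLipschitzBound f = ∞) := fun h =>
    hf (by rw [distortion, if_pos h])
  obtain ⟨hl, hu⟩ := not_or.1 h0
  obtain ⟨x, y, hxy⟩ := exists_pair_ne X
  have hl' : lowerLipschitzBound f ≠ ∞ := by
    intro h
    have := lowerLipschitzBound_mul_edist_le (f := f) x y
    rw [h, ENNReal.top_mul (edist_pos.2 hxy).ne'] at this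
    exact edist_ne_top _ _ (top_le_iff.1 this)
  have hpos := ENNReal.toReal_pos hl hl'
  refine ⟨_, (upperLipschitzBound f).toReal, hpos, fun x y => ?_, fun x y => ?_, ?_⟩
  · have := ENNReal.toReal_mono (edist_ne_top _ _) (lowerLipschitzBound_mul_edist_le (f := f) x y)
    rwa [ENNReal.toReal_mul, ← dist_edist, ← dist_edist] at this
  · have := ENNReal.toReal_mono (ENNReal.mul_ne_top hu (edist_ne_top _ _))
      (edist_le_upperLipschitzBound_mul (f := f) x y)
    rwa [ENNReal.toReal_mul, ← dist_edist, ← dist_edist] at this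
  · rw [ENNReal.ofReal_div_of_pos hpos, ENNReal.ofReal_toReal hu, ENNReal.ofReal_toReal hl',
      distortion, if_neg h0]

end DistortionBounds

/-! ### The bilipschitz embedding -/

section Embedding

open Finset Matrix

variable {r n : ℕ}

theorem dist_toLp_prod_sq {A B : Matrix (Fin n) (Fin n) ℝ}
    {p q : EuclideanSpace ℝ (Fin r ↪o Fin n)} :
    dist (WithLp.toLp 2 (A, p) : GramPluckerSpace r n) (WithLp.toLp 2 (B, q)) ^ 2 =
      ‖A - B‖ ^ 2 + ‖p - q‖ ^ 2 := by
  rw [WithLp.prod_dist_eq_of_L2, Real.sq_sqrt (by positivity), dist_eq_norm, dist_eq_norm]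
  rfl

theorem IsThinSVD.so_mul {X : Matrix (Fin r) (Fin n) ℝ} {U : Matrix (Fin r) (Fin r) ℝ}
    {V : Matrix (Fin r) (Fin n) ℝ} (hX : IsThinSVD X U V) {Q : Matrix (Fin r) (Fin r) ℝ}
    (hQ : Q ∈ specialOrthogonalGroup (Fin r) ℝ) : IsThinSVD (Q * X) (Q * U) V := by
  refine ⟨mul_mem hQ hX.mem_so, hX.mul_transpose, ?_⟩
  simp only [singVal_mul_of_transpose_mul_eq_one (transpose_mul_of_mem_so hQ)]
  conv_lhs => rw [hX.eq_mul]
  simp only [Matrix.mul_assoc]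

theorem gramSqrt_so_mul {Q : Matrix (Fin r) (Fin r) ℝ}
    (hQ : Q ∈ specialOrthogonalGroup (Fin r) ℝ) (X : Matrix (Fin r) (Fin n) ℝ) :
    gramSqrt (Q * X) = gramSqrt X := by
  rw [gramSqrt, gramSqrt, transpose_mul, Matrix.mul_assoc, ← Matrix.mul_assoc Q.transpose,
    transpose_mul_of_mem_so hQ, Matrix.one_mul]

/-- The Lipschitz estimate compares arbitrary decompositions, so taking X = Y yields independence of
the choice. -/
theorem IsThinSVD.smul_plucker_eq (hr : 1 ≤ r) {X : Matrix (Fin r) (Fin n) ℝ}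
    {U U' : Matrix (Fin r) (Fin r) ℝ} {V V' : Matrix (Fin r) (Fin n) ℝ} (h : IsThinSVD X U V)
    (h' : IsThinSVD X U' V') : sigmaMin X • plucker V = sigmaMin X • plucker V' := by
  have := norm_smul_plucker_sub_le hr h h'
  rw [sub_self, norm_zero, zero_pow two_ne_zero] at this
  rw [← sub_eq_zero, ← norm_eq_zero]
  exact pow_eq_zero_iff two_ne_zero |>.1 (le_antisymm this (by positivity))

/-- The map `[X] ↦ (φ(X), √2 σ_min(X) Plü(V_X))`. -/
noncomputable def gramPlucker (hr : 1 ≤ r) (hrn : r ≤ n) (a : MatrixModSO r n) :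
    GramPluckerSpace r n :=
  let X := Function.surjInv OrbitSpace.mk_surjective a
  WithLp.toLp 2 (gramSqrt X,
    √2 • (sigmaMin X • plucker (exists_isThinSVD hr hrn X).choose_spec.choose))

theorem gramPlucker_mk (hr : 1 ≤ r) (hrn : r ≤ n) {X : Matrix (Fin r) (Fin n) ℝ}
    {U : Matrix (Fin r) (Fin r) ℝ} {V : Matrix (Fin r) (Fin n) ℝ} (h : IsThinSVD X U V) :
    gramPlucker hr hrn (OrbitSpace.mk _ X) =
      WithLp.toLp 2 (gramSqrt X, √2 • (sigmaMin X • plucker V)) := by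
  -- The chosen representative of the orbit is QX with Q in SO(r), and QX has the decomposition with
  -- factors QU and V.
  obtain ⟨Q, hQ⟩ := OrbitSpace.mk_eq_mk.1 (Function.surjInv_eq OrbitSpace.mk_surjective
    (OrbitSpace.mk _ X : MatrixModSO r n))
  have hspec := (exists_isThinSVD hr hrn (Function.surjInv OrbitSpace.mk_surjective
    (OrbitSpace.mk _ X : MatrixModSO r n))).choose_spec.choose_spec
  have hX' := h.so_mul Q.2
  simp only [so_smul_def] at hQ
  rw [hQ] at hX'
  unfold gramPlucker
  simp only
  rw [hspec.smul_plucker_eq hr hX', ← hQ, gramSqrt_so_mul Q.2, sigmaMin, sigmaMin,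
    singVal_mul_of_transpose_mul_eq_one (transpose_mul_of_mem_so Q.2)]

theorem dist_gramPlucker_mk_sq (hr : 1 ≤ r) (hrn : r ≤ n) {X Y : Matrix (Fin r) (Fin n) ℝ}
    {Ux Uy : Matrix (Fin r) (Fin r) ℝ} {Vx Vy : Matrix (Fin r) (Fin n) ℝ}
    (hX : IsThinSVD X Ux Vx) (hY : IsThinSVD Y Uy Vy) :
    dist (gramPlucker hr hrn (OrbitSpace.mk _ X)) (gramPlucker hr hrn (OrbitSpace.mk _ Y)) ^ 2 =
      ‖gramSqrt X - gramSqrt Y‖ ^ 2 +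
        2 * ‖sigmaMin X • plucker Vx - sigmaMin Y • plucker Vy‖ ^ 2 := by
  rw [gramPlucker_mk hr hrn hX, gramPlucker_mk hr hrn hY, dist_toLp_prod_sq, ← smul_sub,
    norm_smul, mul_pow, Real.norm_eq_abs, sq_abs, Real.sq_sqrt zero_le_two]

theorem dist_mk_le_norm_sub_mul (X Y : Matrix (Fin r) (Fin n) ℝ) {Q : Matrix (Fin r) (Fin r) ℝ}
    (hQ : Q ∈ specialOrthogonalGroup (Fin r) ℝ) :
    dist (OrbitSpace.mk _ X : MatrixModSO r n) (OrbitSpace.mk _ Y) ≤ ‖X - Q * Y‖ := by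
  refine (OrbitSpace.dist_mk_mk X Y).trans_le ?_
  rw [← dist_eq_norm]
  exact Metric.infDist_le_dist_of_mem ⟨⟨Q, hQ⟩, rfl⟩

theorem dist_gramPlucker_le (hr : 1 ≤ r) (hrn : r ≤ n) (a b : MatrixModSO r n) :
    dist (gramPlucker hr hrn a) (gramPlucker hr hrn b) ≤ 2 * dist a b := by
  have key : ∀ X Y : Matrix (Fin r) (Fin n) ℝ,
      dist (gramPlucker hr hrn (OrbitSpace.mk _ X)) (gramPlucker hr hrn (OrbitSpace.mk _ Y)) ≤
        2 * dist X Y := by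
    intro X Y
    obtain ⟨Ux, Vx, hX⟩ := exists_isThinSVD hr hrn X
    obtain ⟨Uy, Vy, hY⟩ := exists_isThinSVD hr hrn Y
    rw [← sq_le_sq₀ dist_nonneg (by positivity), dist_gramPlucker_mk_sq hr hrn hX hY, dist_eq_norm]
    have h1 := norm_gramSqrt_sub_sq_le hX hY
    have h2 := norm_smul_plucker_sub_le hr hX hY
    nlinarith
  obtain ⟨X, rfl⟩ := OrbitSpace.mk_surjective a
  obtain ⟨Y, rfl⟩ := OrbitSpace.mk_surjective b
  rw [← div_le_iff₀' two_pos]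
  refine le_trans ?_ (OrbitSpace.dist_mk_mk X Y).ge
  rw [Metric.le_infDist (MulAction.nonempty_orbit Y)]
  rintro _ ⟨Q, rfl⟩
  rw [div_le_iff₀' two_pos]
  have h := key X (Q • Y)
  rwa [OrbitSpace.mk_eq_mk.2 (MulAction.mem_orbit Y Q)] at h

theorem dist_le_gramPlucker (hr : 1 ≤ r) (hrn : r ≤ n) (a b : MatrixModSO r n) :
    dist a b ^ 2 ≤ 2 * dist (gramPlucker hr hrn a) (gramPlucker hr hrn b) ^ 2 := by
  obtain ⟨X, rfl⟩ := OrbitSpace.mk_surjective a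
  obtain ⟨Y, rfl⟩ := OrbitSpace.mk_surjective b
  obtain ⟨Ux, Vx, hX⟩ := exists_isThinSVD hr hrn X
  obtain ⟨Uy, Vy, hY⟩ := exists_isThinSVD hr hrn Y
  rw [dist_gramPlucker_mk_sq hr hrn hX hY]
  set δ := ‖gramSqrt X - gramSqrt Y‖ with hδ
  rcases le_or_gt 0 (Vx * Vy.transpose).det with h | h
  · obtain ⟨Q, hQ, hQd, hle⟩ :=
      exists_orthogonal_norm_sub_mul_le hr hX hY (Or.inl rfl) (by rwa [one_mul])
    have h1 := (dist_mk_le_norm_sub_mul X Y (mem_specialOrthogonalGroup_of hQ hQd)).trans hle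
    have h2 := pow_le_pow_left₀ dist_nonneg h1 2
    nlinarith [sq_nonneg δ, sq_nonneg ‖sigmaMin X • plucker Vx - sigmaMin Y • plucker Vy‖]
  · obtain ⟨Q, hQ, hQd, hle⟩ :=
      exists_orthogonal_norm_sub_mul_le hr hX hY (Or.inr rfl) (by linarith)
    have hx0 := sigmaMin_nonneg X
    have hy0 := sigmaMin_nonneg Y
    -- Here det Q = -1; composing with a reflection of the smallest singular direction gives a
    -- rotation, at cost 2 σ_min.
    have hXle : dist (OrbitSpace.mk _ X : MatrixModSO r n) (OrbitSpace.mk _ Y) ≤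
        δ + 2 * sigmaMin X := by
      obtain ⟨R, hR, hRd, hRX⟩ := hX.exists_reflection hr
      refine (dist_mk_le_norm_sub_mul X Y (Q := R * Q)
        (mem_specialOrthogonalGroup_of (mul_mul_transpose_mul_eq_one hR hQ)
          (by rw [det_mul, hRd, hQd]; norm_num))).trans ?_
      have : X - R * Q * Y = R * (X - Q * Y) + (X - R * X) := by
        rw [Matrix.mul_sub, Matrix.mul_assoc]; abel
      rw [this]
      refine (norm_add_le _ _).trans (add_le_add ?_ hRX)
      rw [frobenius_norm_orthogonal_mul (mul_eq_one_comm.1 hR)]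
      exact hle
    have hYle : dist (OrbitSpace.mk _ X : MatrixModSO r n) (OrbitSpace.mk _ Y) ≤
        δ + 2 * sigmaMin Y := by
      obtain ⟨R, hR, hRd, hRY⟩ := hY.exists_reflection hr
      refine (dist_mk_le_norm_sub_mul X Y (Q := Q * R)
        (mem_specialOrthogonalGroup_of (mul_mul_transpose_mul_eq_one hQ hR)
          (by rw [det_mul, hRd, hQd]; norm_num))).trans ?_
      have : X - Q * R * Y = (X - Q * Y) + Q * (Y - R * Y) := by
        rw [Matrix.mul_sub, Matrix.mul_assoc]; abel
      rw [this]
      refine (norm_add_le _ _).trans (add_le_add hle ?_)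
      rw [frobenius_norm_orthogonal_mul (mul_eq_one_comm.1 hQ)]
      exact hRY
    have hle2 : dist (OrbitSpace.mk _ X : MatrixModSO r n) (OrbitSpace.mk _ Y) ≤
        δ + (sigmaMin X + sigmaMin Y) := by linarith
    have h2 := pow_le_pow_left₀ dist_nonneg hle2 2
    rw [norm_smul_plucker_sub_sq hX hY]
    have h3 : 0 ≤ (sigmaMin X * sigmaMin Y) * -(Vx * Vy.transpose).det :=
      mul_nonneg (mul_nonneg hx0 hy0) (by linarith)
    -- With det N < 0 the Plücker term is at least a² + b² ≥ (a + b)²/2, and (δ + (a + b))² ≤ 2δ² +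
    -- 2(a + b)².
    nlinarith [sq_nonneg (δ - (sigmaMin X + sigmaMin Y)), sq_nonneg (sigmaMin X - sigmaMin Y)]

theorem inv_sqrt_two_mul_dist_le_gramPlucker (hr : 1 ≤ r) (hrn : r ≤ n) (a b : MatrixModSO r n) :
    (√2)⁻¹ * dist a b ≤ dist (gramPlucker hr hrn a) (gramPlucker hr hrn b) := by
  rw [inv_mul_le_iff₀ (by positivity), ← sq_le_sq₀ dist_nonneg (by positivity), mul_pow,
    Real.sq_sqrt zero_le_two]
  exact dist_le_gramPlucker hr hrn a b

/-- The isometry g lets one estimate serve both F itself and its copy in a Euclidean space of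
prescribed universe. -/
theorem distortion_le_two_mul_sqrt_two (hr : 1 ≤ r) (hrn : r ≤ n) {Z : Type w} [MetricSpace Z]
    {g : GramPluckerSpace r n → Z} (hg : Isometry g) :
    distortion (g ∘ gramPlucker hr hrn) ≤ ENNReal.ofReal (2 * √2) := by
  have := distortion_le_of_bounds (f := g ∘ gramPlucker hr hrn) (α := (√2)⁻¹) (β := 2)
    (by positivity)
    (fun a b => (inv_sqrt_two_mul_dist_le_gramPlucker hr hrn a b).trans (hg.dist_eq _ _).ge)
    (fun a b => (hg.dist_eq _ _).trans_le (dist_gramPlucker_le hr hrn a b))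
  rwa [div_inv_eq_mul] at this

/-- Coordinates on `GramPluckerSpace`, valued in a Euclidean space in an arbitrary universe. -/
noncomputable def gramPluckerCoord (p : GramPluckerSpace r n) :
    EuclideanSpace ℝ (ULift.{v} ((Fin n × Fin n) ⊕ (Fin r ↪o Fin n))) :=
  WithLp.toLp 2 fun i => Sum.elim (fun x => p.fst x.1 x.2) (fun s => p.snd s) i.down

theorem isometry_gramPluckerCoord : Isometry (gramPluckerCoord.{v} (r := r) (n := n)) := by
  refine Isometry.of_dist_eq fun p q => ?_
  rw [← sq_eq_sq₀ dist_nonneg dist_nonneg, WithLp.prod_dist_eq_of_L2,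
    Real.sq_sqrt (by positivity), EuclideanSpace.dist_eq, Real.sq_sqrt (by positivity),
    dist_eq_norm, frobenius_norm_sq_eq_sum, EuclideanSpace.dist_eq, Real.sq_sqrt (by positivity),
    ← Equiv.ulift.symm.sum_comp, Fintype.sum_sum_type, Fintype.sum_prod_type, sum_comm]
  congr 1
  refine sum_congr rfl fun j _ => sum_congr rfl fun i _ => ?_
  exact sq_abs _

theorem euclideanDistortion_le (hr : 1 ≤ r) (hrn : r ≤ n) :
    euclideanDistortion.{0, v} (MatrixModSO r n) ≤ ENNReal.ofReal (2 * √2) :=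
  le_trans (sInf_le ⟨EuclideanSpace ℝ (ULift.{v} ((Fin n × Fin n) ⊕ (Fin r ↪o Fin n))),
      inferInstance, inferInstance, inferInstance, gramPluckerCoord.{v} ∘ gramPlucker hr hrn, rfl⟩)
    (distortion_le_two_mul_sqrt_two hr hrn isometry_gramPluckerCoord.{v})

end Embedding

/-! ### The lower bound for the Euclidean distortion -/

section LowerBound

open Finset Matrix

theorem sum_range_shift_of_periodic {p : ℕ → ℝ} {N : ℕ} (hp : ∀ i, p (i + N) = p i) (k : ℕ) :
    ∑ i ∈ range N, p (i + k) = ∑ i ∈ range N, p i := by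
  induction k with
  | zero => rfl
  | succ k ih =>
    rw [← ih]
    have h1 := sum_range_succ (fun i => p (i + k)) N
    have h2 := sum_range_succ' (fun i => p (i + k)) N
    have h3 : p (N + k) = p (0 + k) := by rw [zero_add, add_comm, hp]
    have h4 : ∑ i ∈ range N, p (i + (k + 1)) = ∑ i ∈ range N, p (i + 1 + k) :=
      sum_congr rfl fun i _ => by rw [add_assoc, add_comm 1 k]
    rw [h4]
    linarith

/-- A discrete Wirtinger inequality for closed polygons in a Hilbert space. -/
theorem sum_norm_antipodal_sq_le {H : Type v} [NormedAddCommGroup H] [InnerProductSpace ℝ H]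
    {f : ℕ → H} {m : ℕ} (hm : 1 ≤ m) (hf : ∀ i, f (i + 2 * m) = f i) :
    (2 - 2 * Real.cos (Real.pi / m)) * ∑ i ∈ range (2 * m), ‖f (i + m) - f i‖ ^ 2 ≤
      4 * ∑ i ∈ range (2 * m), ‖f (i + 1) - f i‖ ^ 2 := by
  let g : ℕ → H := fun i => f (i + m) - f i
  have hg : ∀ i, g (i + 2 * m) = g i := fun i => by
    simp only [g]
    rw [add_right_comm, hf, hf]
  -- The cyclic shifts of the diagonals g have equal norm and equal consecutive angles, and m shifts
  -- lead from G 0 to -G 0. Hence one shift turns by an angle of at least π/m.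
  let G : ℕ → PiLp 2 (fun _ : Fin (2 * m) => H) := fun k => WithLp.toLp 2 fun i => g (i + k)
  have hinner : ∀ k l, inner ℝ (G k) (G l) =
      ∑ i ∈ range (2 * m), inner ℝ (g (i + k)) (g (i + l)) := by
    intro k l
    rw [PiLp.inner_apply]
    exact Fin.sum_univ_eq_sum_range (fun i => inner ℝ (g (i + k)) (g (i + l))) (2 * m)
  have hshift : ∀ k l, inner ℝ (G k) (G (k + l)) = inner ℝ (G 0) (G l) := by
    intro k l
    rw [hinner, hinner, ← sum_range_shift_of_periodic
      (p := fun i => inner ℝ (g (i + 0)) (g (i + l))) (fun i => ?_) k]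
    · exact sum_congr rfl fun i _ => by rw [add_zero, add_assoc]
    · simp only [add_zero]
      rw [hg, add_right_comm, hg]
  have hnorm : ∀ k, ‖G k‖ = ‖G 0‖ := by
    intro k
    rw [← sq_eq_sq₀ (norm_nonneg _) (norm_nonneg _), ← real_inner_self_eq_norm_sq,
      ← real_inner_self_eq_norm_sq]
    exact hshift k 0
  have hnorm0 : ‖G 0‖ ^ 2 = ∑ i ∈ range (2 * m), ‖f (i + m) - f i‖ ^ 2 := by
    rw [← real_inner_self_eq_norm_sq, hinner]
    exact sum_congr rfl fun i _ => real_inner_self_eq_norm_sq _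
  have hanti : G m = -G 0 := by
    ext i
    change f (i + m + m) - f (i + m) = -(f (i + 0 + m) - f (i + 0))
    rw [add_zero, add_assoc, ← two_mul, hf, neg_sub]
  -- The term angle (G 0) (G 0) covers the case G 0 = 0, where the angle is π/2 by convention.
  have hangle : ∀ k : ℕ, InnerProductGeometry.angle (G 0) (G k) ≤
      InnerProductGeometry.angle (G 0) (G 0) + k * InnerProductGeometry.angle (G 0) (G 1) := by
    intro k
    induction k with
    | zero => simp
    | succ k ih =>
      have h1 := InnerProductGeometry.angle_le_angle_add_angle (G 0) (G k) (G (k + 1))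
      have h2 : InnerProductGeometry.angle (G k) (G (k + 1)) =
          InnerProductGeometry.angle (G 0) (G 1) := by
        rw [InnerProductGeometry.angle, InnerProductGeometry.angle, hshift, hnorm, hnorm (k + 1),
          hnorm 1]
      push_cast
      linarith
  have hcos : inner ℝ (G 0) (G 1) ≤ Real.cos (Real.pi / m) * ‖G 0‖ ^ 2 := by
    by_cases h0 : G 0 = 0
    · simp [h0]
    have h1 := hangle m
    rw [hanti, InnerProductGeometry.angle_self_neg_of_nonzero h0,
      InnerProductGeometry.angle_self h0, zero_add] at h1
    have hm' : (0 : ℝ) < m := by exact_mod_cast hm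
    rw [← InnerProductGeometry.cos_angle_mul_norm_mul_norm, hnorm 1, ← sq]
    refine mul_le_mul_of_nonneg_right ?_ (sq_nonneg _)
    refine Real.cos_le_cos_of_nonneg_of_le_pi (by positivity)
      (InnerProductGeometry.angle_le_pi _ _) ?_
    rwa [div_le_iff₀' hm']
  have hdiff : ‖G 1 - G 0‖ ^ 2 ≤ 4 * ∑ i ∈ range (2 * m), ‖f (i + 1) - f i‖ ^ 2 := by
    have h1 : ‖G 1 - G 0‖ ^ 2 = ∑ i ∈ range (2 * m), ‖g (i + 1) - g i‖ ^ 2 := by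
      rw [PiLp.norm_sq_eq_of_L2]
      exact Fin.sum_univ_eq_sum_range (fun i => ‖g (i + 1) - g i‖ ^ 2) (2 * m)
    have h2 : ∑ i ∈ range (2 * m), ‖f (i + m + 1) - f (i + m)‖ ^ 2 =
        ∑ i ∈ range (2 * m), ‖f (i + 1) - f i‖ ^ 2 :=
      sum_range_shift_of_periodic (p := fun i => ‖f (i + 1) - f i‖ ^ 2)
        (fun i => by rw [add_right_comm, hf, hf]) m
    have h3 : ∀ i, ‖g (i + 1) - g i‖ ^ 2 ≤
        2 * ‖f (i + m + 1) - f (i + m)‖ ^ 2 + 2 * ‖f (i + 1) - f i‖ ^ 2 := by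
      intro i
      have e : g (i + 1) - g i = (f (i + m + 1) - f (i + m)) - (f (i + 1) - f i) := by
        simp only [g]
        rw [add_right_comm i 1 m]
        abel
      rw [e]
      have := norm_sub_le (f (i + m + 1) - f (i + m)) (f (i + 1) - f i)
      have h4 := pow_le_pow_left₀ (norm_nonneg _) this 2
      nlinarith [sq_nonneg (‖f (i + m + 1) - f (i + m)‖ - ‖f (i + 1) - f i‖)]
    rw [h1]
    refine (sum_le_sum fun i _ => h3 i).trans ?_
    rw [sum_add_distrib, ← mul_sum, ← mul_sum, h2]
    linarith
  rw [norm_sub_sq_real, hnorm 1, real_inner_comm] at hdiff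
  rw [← hnorm0]
  linarith

variable {r n : ℕ}

theorem trace_transpose_vecMulVec_mul (a c : Fin r → ℝ) (b d : Fin n → ℝ) :
    ((vecMulVec a b).transpose * vecMulVec c d).trace = (a ⬝ᵥ c) * (b ⬝ᵥ d) := by
  rw [transpose_vecMulVec, vecMulVec_mul_vecMulVec, trace_vecMulVec, dotProduct_smul, smul_eq_mul]

/-- A unit vector at angle `θ` in the plane of the `i`-th and the `j`-th coordinate. -/
noncomputable def planeVec (i j : Fin n) (θ : ℝ) : Fin n → ℝ :=
  Real.cos θ • Pi.single i 1 + Real.sin θ • Pi.single j 1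

theorem planeVec_dotProduct {i j : Fin n} (hij : i ≠ j) (θ φ : ℝ) :
    planeVec i j θ ⬝ᵥ planeVec i j φ = Real.cos (θ - φ) := by
  simp [planeVec, hij, hij.symm, Real.cos_sub, mul_comm]

theorem planeVec_add_pi (i j : Fin n) (θ : ℝ) : planeVec i j (θ + Real.pi) = -planeVec i j θ := by
  rw [planeVec, planeVec, Real.cos_add_pi, Real.sin_add_pi, neg_smul, neg_smul, neg_add]

/-- The rank one matrix with first row `planeVec`. -/
noncomputable def planeMat (k : Fin r) (i j : Fin n) (θ : ℝ) : Matrix (Fin r) (Fin n) ℝ :=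
  vecMulVec (Pi.single k 1) (planeVec i j θ)

theorem norm_planeMat_sub_mul_sq (k : Fin r) {i j : Fin n} (hij : i ≠ j) (θ φ : ℝ)
    {Q : Matrix (Fin r) (Fin r) ℝ} (hQ : Q.transpose * Q = 1) :
    ‖planeMat k i j θ - Q * planeMat k i j φ‖ ^ 2 = 2 - 2 * (Q k k * Real.cos (θ - φ)) := by
  have h1 : ∀ ψ, ‖planeMat k i j ψ‖ ^ 2 = 1 := fun ψ => by
    rw [planeMat, frobenius_norm_sq, trace_transpose_vecMulVec_mul, planeVec_dotProduct hij]
    simp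
  rw [frobenius_norm_sub_sq, frobenius_norm_orthogonal_mul hQ, h1, h1, planeMat, planeMat,
    mul_vecMulVec Q, trace_transpose_vecMulVec_mul, planeVec_dotProduct hij, ← Real.cos_neg (φ - θ)]
  simp
  ring

theorem dist_mk_planeMat_sq_le (k : Fin r) {i j : Fin n} (hij : i ≠ j) (θ φ : ℝ) :
    dist (OrbitSpace.mk _ (planeMat k i j θ) : MatrixModSO r n)
      (OrbitSpace.mk _ (planeMat k i j φ)) ^ 2 ≤ 2 - 2 * Real.cos (θ - φ) := by
  have h := dist_mk_le_norm_sub_mul (planeMat k i j θ) (planeMat k i j φ) (one_mem _)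
  refine (pow_le_pow_left₀ dist_nonneg h 2).trans ?_
  rw [norm_planeMat_sub_mul_sq k hij θ φ (by simp)]
  simp

/-- The two row vectors are orthogonal, so the cross term vanishes for every rotation Q. -/
theorem two_le_dist_mk_planeMat_sq (k : Fin r) {i j : Fin n} (hij : i ≠ j) (θ : ℝ) :
    2 ≤ dist (OrbitSpace.mk _ (planeMat k i j (θ + Real.pi / 2)) : MatrixModSO r n)
      (OrbitSpace.mk _ (planeMat k i j θ)) ^ 2 := by
  have h : √2 ≤ dist (OrbitSpace.mk _ (planeMat k i j (θ + Real.pi / 2)) : MatrixModSO r n)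
      (OrbitSpace.mk _ (planeMat k i j θ)) := by
    refine le_trans ?_ (OrbitSpace.dist_mk_mk _ _).ge
    rw [Metric.le_infDist (MulAction.nonempty_orbit _)]
    rintro _ ⟨Q, rfl⟩
    refine Real.sqrt_le_iff.2 ⟨dist_nonneg, ?_⟩
    simp only [so_smul_def]
    rw [dist_eq_norm, norm_planeMat_sub_mul_sq k hij _ _ (transpose_mul_of_mem_so Q.2)]
    simp
  have := pow_le_pow_left₀ (Real.sqrt_nonneg 2) h 2
  rwa [Real.sq_sqrt zero_le_two] at this

/-- This is where r ≥ 2 enters: negating row k needs a second sign flip to have determinant 1, and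
row l is zero. -/
theorem mk_planeMat_add_pi {k l : Fin r} (hkl : k ≠ l) (i j : Fin n) (θ : ℝ) :
    (OrbitSpace.mk _ (planeMat k i j (θ + Real.pi)) : MatrixModSO r n) =
      OrbitSpace.mk _ (planeMat k i j θ) := by
  have hs : ∀ i : Fin r, signFlip i * (signFlip i).transpose = 1 := fun i => by
    rw [transpose_signFlip, signFlip_mul_self]
  refine OrbitSpace.mk_eq_mk.2 ⟨⟨signFlip k * signFlip l, mem_specialOrthogonalGroup_of
    (mul_mul_transpose_mul_eq_one (hs k) (hs l)) ?_⟩, ?_⟩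
  · rw [det_mul, det_signFlip, det_signFlip]; norm_num
  · simp only [so_smul_def]
    rw [planeMat, planeMat, mul_vecMulVec, planeVec_add_pi]
    have : (signFlip k * signFlip l) *ᵥ Pi.single k (1 : ℝ) = -Pi.single k 1 := by
      ext x
      simp only [signFlip, diagonal_mul_diagonal, diagonal_mulVec_single]
      by_cases h : x = k
      · subst h; simp [hkl]
      · simp [h]
    rw [this, neg_vecMulVec, vecMulVec_neg]

theorem sqrt_two_le_euclideanDistortion (hr : 2 ≤ r) (hrn : r ≤ n) :
    ENNReal.ofReal √2 ≤ euclideanDistortion.{0, v} (MatrixModSO r n) := by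
  set k : Fin r := ⟨0, by omega⟩
  set l : Fin r := ⟨1, by omega⟩
  set i : Fin n := ⟨0, by omega⟩
  set j : Fin n := ⟨1, by omega⟩
  have hkl : k ≠ l := by simp [k, l]
  have hij : i ≠ j := by simp [i, j]
  let x : ℝ → MatrixModSO r n := fun θ => OrbitSpace.mk _ (planeMat k i j θ)
  have : Nontrivial (MatrixModSO r n) := by
    refine ⟨x (0 + Real.pi / 2), x 0, fun h => ?_⟩
    have := two_le_dist_mk_planeMat_sq k hij 0
    change 2 ≤ dist (x _) (x _) ^ 2 at this
    rw [h, dist_self] at this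
    norm_num at this
  refine le_sInf ?_
  rintro _ ⟨H, _, _, _, F, rfl⟩
  by_cases htop : distortion F = ∞
  · rw [htop]; exact le_top
  obtain ⟨α, β, hα, hlow, hup, heq⟩ := exists_bounds_of_distortion_ne_top htop
  rw [heq]
  refine ENNReal.ofReal_le_ofReal ?_
  have hβ : 0 ≤ β := by
    obtain ⟨y, z, hyz⟩ := exists_pair_ne (MatrixModSO r n)
    have h := dist_nonneg.trans (hup y z)
    exact nonneg_of_mul_nonneg_left h (dist_pos.2 hyz)
  have key : ∀ m : ℕ, α ^ 2 * (1 + Real.cos (Real.pi / (2 * (m + 1 : ℕ)))) ≤ β ^ 2 := by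
    intro m
    set M := m + 1 with hM
    have hM0 : (0 : ℝ) < M := by positivity
    -- With this step, 2M steps make a half turn and close the polygon in the orbit space, and M
    -- steps make a quarter turn, where the distance is at least √2.
    set t : ℝ := Real.pi / (2 * M) with ht
    have htM : t * M = Real.pi / 2 := by rw [ht]; field_simp
    have ht0 : 0 < t := by positivity
    have htpi : t < Real.pi := by
      rw [ht, div_lt_iff₀ (by positivity)]
      have : (1 : ℝ) ≤ M := by rw [hM]; push_cast; linarith [(Nat.cast_nonneg m : (0 : ℝ) ≤ m)]
      nlinarith [Real.pi_pos]
    have hper : ∀ i : ℕ, F (x (t * (i + 2 * M : ℕ))) = F (x (t * i)) := by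
      intro a
      have : t * (a + 2 * M : ℕ) = t * a + Real.pi := by
        push_cast; linear_combination 2 * htM
      rw [this]
      exact congrArg F (mk_planeMat_add_pi hkl i j _)
    have hW := sum_norm_antipodal_sq_le (f := fun a : ℕ => F (x (t * a))) (m := M) (by omega) hper
    have h1 : (2 * M : ℝ) * (α ^ 2 * 2) ≤
        ∑ a ∈ range (2 * M), ‖F (x (t * (a + M : ℕ))) - F (x (t * a))‖ ^ 2 := by
      have : ∀ a ∈ range (2 * M), α ^ 2 * 2 ≤ ‖F (x (t * (a + M : ℕ))) - F (x (t * a))‖ ^ 2 := by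
        intro a _
        have e : t * (a + M : ℕ) = t * a + Real.pi / 2 := by push_cast; linear_combination htM
        rw [e, ← dist_eq_norm]
        refine le_trans ?_ (pow_le_pow_left₀ (by positivity) (hlow _ _) 2)
        rw [mul_pow]
        exact mul_le_mul_of_nonneg_left (two_le_dist_mk_planeMat_sq k hij _) (sq_nonneg α)
      have h := card_nsmul_le_sum _ _ _ this
      rw [card_range, nsmul_eq_mul] at h
      exact_mod_cast h
    have h2 : ∑ a ∈ range (2 * M), ‖F (x (t * (a + 1 : ℕ))) - F (x (t * a))‖ ^ 2 ≤
        (2 * M : ℝ) * (β ^ 2 * (2 - 2 * Real.cos t)) := by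
      have : ∀ a ∈ range (2 * M), ‖F (x (t * (a + 1 : ℕ))) - F (x (t * a))‖ ^ 2 ≤
          β ^ 2 * (2 - 2 * Real.cos t) := by
        intro a _
        rw [← dist_eq_norm]
        refine (pow_le_pow_left₀ dist_nonneg (hup _ _) 2).trans ?_
        rw [mul_pow]
        refine mul_le_mul_of_nonneg_left ?_ (sq_nonneg β)
        refine (dist_mk_planeMat_sq_le k hij _ _).trans_eq ?_
        congr 3
        push_cast; ring
      have h := sum_le_card_nsmul _ _ _ this
      rw [card_range, nsmul_eq_mul] at h
      exact_mod_cast h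
    have hcos : Real.cos (Real.pi / M) = 2 * Real.cos t ^ 2 - 1 := by
      rw [← Real.cos_two_mul, ht]
      congr 1
      field_simp
    have hc1 : Real.cos t < 1 := by
      have := Real.cos_lt_cos_of_nonneg_of_le_pi le_rfl htpi.le ht0
      rwa [Real.cos_zero] at this
    have hc2 : -1 ≤ Real.cos t := Real.neg_one_le_cos t
    have h3 : (2 - 2 * Real.cos (Real.pi / M)) * ((2 * M : ℝ) * (α ^ 2 * 2)) ≤
        4 * ((2 * M : ℝ) * (β ^ 2 * (2 - 2 * Real.cos t))) := by
      refine (mul_le_mul_of_nonneg_left h1 ?_).trans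
        (hW.trans (mul_le_mul_of_nonneg_left h2 (by norm_num)))
      linarith [Real.cos_le_one (Real.pi / M)]
    rw [hcos] at h3
    -- By the double angle formula 2 - 2 cos(π/M) = 4(1 - cos t)(1 + cos t), so the positive factor
    -- 16M(1 - cos t) cancels.
    have h4 : (16 * M * (1 - Real.cos t)) * (α ^ 2 * (1 + Real.cos t)) ≤
        (16 * M * (1 - Real.cos t)) * β ^ 2 := by linarith
    exact le_of_mul_le_mul_left h4 (by have := sub_pos.2 hc1; positivity)
  -- Refining the polygon sends cos t to 1 and leaves 2α² ≤ β².
  have hlim : Filter.Tendsto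
      (fun m : ℕ => α ^ 2 * (1 + Real.cos (Real.pi / (2 * (m + 1 : ℕ))))) Filter.atTop
      (nhds (α ^ 2 * (1 + Real.cos 0))) := by
    refine ((Real.continuous_cos.tendsto 0).comp ?_ |>.const_add 1).const_mul _
    have h1 := (tendsto_const_div_atTop_nhds_zero_nat (Real.pi / 2)).comp
      (Filter.tendsto_add_atTop_nat 1)
    refine h1.congr fun m => ?_
    simp only [Function.comp]
    rw [div_div]
  have h2 := le_of_tendsto' hlim key
  rw [Real.cos_zero] at h2
  rw [le_div_iff₀ hα]
  refine le_of_sq_le_sq ?_ hβ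
  rw [mul_pow, Real.sq_sqrt zero_le_two]
  linarith

end LowerBound

theorem mainTheorem7 (r n : ℕ) (hr : 1 ≤ r) (hrn : r ≤ n) :
    (∃ F : MatrixModSO r n → GramPluckerSpace r n,
      (∀ X : Matrix (Fin r) (Fin n) ℝ,
        (∃ (U : Matrix (Fin r) (Fin r) ℝ) (V : Matrix (Fin r) (Fin n) ℝ), IsThinSVD X U V) ∧
        ∀ (U : Matrix (Fin r) (Fin r) ℝ) (V : Matrix (Fin r) (Fin n) ℝ), IsThinSVD X U V →
          F (OrbitSpace.mk _ X) =
            WithLp.toLp 2 (gramSqrt X, √2 • (sigmaMin X • plucker V))) ∧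
      distortion F ≤ ENNReal.ofReal (2 * √2)) ∧
    (2 ≤ r →
      ENNReal.ofReal √2 ≤ euclideanDistortion.{0, v} (MatrixModSO r n) ∧
      euclideanDistortion.{0, v} (MatrixModSO r n) ≤ ENNReal.ofReal (2 * √2)) :=
  ⟨⟨gramPlucker hr hrn,
    fun X => ⟨exists_isThinSVD hr hrn X, fun _ _ h => gramPlucker_mk hr hrn h⟩,
    distortion_le_two_mul_sqrt_two hr hrn isometry_id⟩,
    fun hr2 => ⟨sqrt_two_le_euclideanDistortion hr2 hrn, euclideanDistortion_le hr hrn⟩⟩
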